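/- **Conventions.** $G$ is a finite simple graph. A (planar) *drawing* of $G$ assigns to every vertex an axis-aligned box (possibly degenerated to a segment or a point) and to every edge $uv$ a poly-line between the boxes of $u$ and $v$ that meets each of these two boxes only in its end there (the attachment point). Corners of boxes, attachment points and bends (the places where an edge changes direction) have integer coordinates. Boxes of distinct vertices are disjoint, no edge curve intersects itself or the box of a vertex that is not an endpoint of it, and the curves of distinct edges intersect only in the boxes of common endpoints. A drawing is *poly-line* if all vertex boxes are points, *orthogonal* if all segments of edges are horizontal or vertical, *flat* if all vertex boxes are (possibly one-point) horizontal segments, and *$y$-monotone* if along every edge the $y$-coordinate is nondecreasing or nonincreasing (horizontal segments are allowed). **Theorem.** Let $\Gamma$ be a planar poly-line drawing of $G$. Then $G$ has a planar flat orthogonal drawing $\Gamma'$ such that 1. $\Gamma'$ has the same $y$-coordinates: every vertex has the same $y$-coordinate in $\Gamma'$ as in $\Gamma$, and along every edge the bends of $\Gamma'$ arise from those of $\Gamma$, in the same order, where each bend of $\Gamma$ is either removed or becomes one or several consecutive bends of $\Gamma'$ with the same $y$-coordinate; 2. $\Gamma'$ has the same left-to-right order in each row: if two vertices $v,w$ have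 the same $y$-coordinate in $\Gamma$, with $v$ left of $w$, then the segment of $v$ lies to the left of the segment of $w$ in $\Gamma'$; 3. if $\Gamma$ is $y$-monotone, then so is $\Gamma'$. -/

import Mathlib

namespace GraphDrawing

/-- Grid points: the points of the plane with integer coordinates `(x, y)`. -/
abbrev GridPt : Type := ℤ × ℤ

/-- The grid point `p`, seen as a point of the real plane. -/
def GridPt.toPlane (p : GridPt) : ℝ × ℝ := ((p.1 : ℝ), (p.2 : ℝ))

/-- An axis-aligned box with integer corners. It may be degenerate: a horizontal or
vertical segment, or a single point. -/
structure Box where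
  /-- the lower left corner -/
  lo : GridPt
  /-- the upper right corner -/
  hi : GridPt
  lo_le_hi : lo ≤ hi

/-- The closed region of the plane that is covered by a box, namely
`[lo.x, hi.x] × [lo.y, hi.y]`. -/
def Box.region (B : Box) : Set (ℝ × ℝ) := Set.Icc B.lo.toPlane B.hi.toPlane

/-- The poly-line with successive corners `l`, as a set of points of the plane. -/
def trace : List GridPt → Set (ℝ × ℝ)
  | [] => ∅
  | [p] => {p.toPlane}
  | p :: q :: l => segment ℝ p.toPlane q.toPlane ∪ trace (q :: l)

/-- The poly-line with successive corners `l` does not intersect itself: each of its segments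
meets the part of the poly-line that comes after it only in the corner where they join. -/
def NotSelfIntersecting : List GridPt → Prop
  | p :: q :: r :: l =>
      segment ℝ p.toPlane q.toPlane ∩ trace (q :: r :: l) ⊆ {q.toPlane} ∧
        NotSelfIntersecting (q :: r :: l)
  | _ => True

/-- At each interior corner of the poly-line the direction changes (the three corners
`p, q, r` do not lie on a line), so that the interior corners are exactly the bends. -/
def ProperBends : List GridPt → Prop
  | p :: q :: r :: l =>
      (q.1 - p.1) * (r.2 - q.2) ≠ (q.2 - p.2) * (r.1 - q.1) ∧ ProperBends (q :: r :: l)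
  | _ => True

/-- A planar drawing of the graph `G` on the integer grid, with a point or box for each vertex
and a poly-line for each edge. The curve of the edge `uv` is recorded once for each of its two
directions, from `u` to `v` and, with its corners reversed, from `v` to `u`. -/
structure Drawing {V : Type*} (G : SimpleGraph V) where
  /-- the point or box of a vertex -/
  box : V → Box
  /-- the corners of the curve of an edge `d`, from the attachment point at `d.fst`, through the
  bends, to the attachment point at `d.snd` -/
  path : G.Dart → List GridPt
  path_symm : ∀ d : G.Dart, path d.symm = (path d).reverse
  /-- The curve of an edge starts at a point of the box of its first endpoint, and it has no
  other point in that box. (By `path_symm`, the same holds at the second endpoint.) -/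
  attached : ∀ d : G.Dart, ∃ a : GridPt, (path d).head? = some a ∧
    trace (path d) ∩ (box d.fst).region = {a.toPlane}
  properBends : ∀ d : G.Dart, ProperBends (path d)
  notSelfIntersecting : ∀ d : G.Dart, NotSelfIntersecting (path d)
  /-- the boxes of distinct vertices do not intersect -/
  disjoint_boxes : ∀ u v : V, u ≠ v → Disjoint (box u).region (box v).region
  /-- the curve of an edge does not intersect the box of a vertex that is not an endpoint -/
  disjoint_path_box : ∀ (d : G.Dart) (v : V), v ∉ d.edge →
    Disjoint (trace (path d)) (box v).region
  /-- the curves of distinct edges do not intersect except at common endpoints -/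
  path_inter_path : ∀ d d' : G.Dart, d.edge ≠ d'.edge →
    ∀ p ∈ trace (path d) ∩ trace (path d'), ∃ v, v ∈ d.edge ∧ v ∈ d'.edge ∧ p ∈ (box v).region

namespace Drawing

variable {V : Type*} {G : SimpleGraph V}

/-- The bends of an edge, in their order along the edge. -/
def bends (Γ : Drawing G) (d : G.Dart) : List GridPt := (Γ.path d).tail.dropLast

/-- A poly-line drawing: all vertices are points. -/
def IsPolyLine (Γ : Drawing G) : Prop := ∀ v, (Γ.box v).lo = (Γ.box v).hi

/-- An orthogonal drawing: all segments of edges are horizontal or vertical. -/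
def IsOrthogonal (Γ : Drawing G) : Prop :=
  ∀ d, (Γ.path d).IsChain (fun p q => p.1 = q.1 ∨ p.2 = q.2)

/-- A flat drawing: the boxes of all vertices have degenerated into horizontal segments. -/
def IsFlat (Γ : Drawing G) : Prop := ∀ v, (Γ.box v).lo.2 = (Γ.box v).hi.2

/-- A `y`-monotone drawing: along each edge, `y` is nondecreasing or nonincreasing. -/
def IsYMonotone (Γ : Drawing G) : Prop :=
  ∀ d, (Γ.path d).Pairwise (fun p q => p.2 ≤ q.2) ∨ (Γ.path d).Pairwise (fun p q => q.2 ≤ p.2)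

/-- `Γ'` has the same `y`-coordinates as `Γ`: each vertex has the same `y`-coordinates, and along
each edge the bends of `Γ'` arise from the bends of `Γ`, where each bend of `Γ` is removed or
becomes one or several consecutive bends with the same `y`-coordinate. -/
def SameY (Γ Γ' : Drawing G) : Prop :=
  (∀ v, (Γ'.box v).lo.2 = (Γ.box v).lo.2 ∧ (Γ'.box v).hi.2 = (Γ.box v).hi.2) ∧
  ∀ d, ∃ groups : List (List GridPt), groups.flatten = Γ'.bends d ∧
    List.Forall₂ (fun (b : GridPt) (g : List GridPt) => ∀ q ∈ g, q.2 = b.2) (Γ.bends d) groups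

/-- `Γ'` has the same left-to-right order in each row as `Γ` (both drawings flat, with the same
`y`-coordinates of vertices): if `v` and `w` are in the same row of `Γ`, with `v` left of `w`,
then `v` is also left of `w` in `Γ'`. -/
def SameRowOrder (Γ Γ' : Drawing G) : Prop :=
  ∀ v w, (Γ.box v).lo.2 = (Γ.box w).lo.2 → (Γ.box v).hi.1 < (Γ.box w).lo.1 →
    (Γ'.box v).hi.1 < (Γ'.box w).lo.1

end Drawing

end GraphDrawing

namespace GraphDrawing

/-! ### Linear extensions -/

/-! Call objects the vertices (as degenerate segments) and the non-horizontal segments of edges.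
Each object gets an integer label. In the new drawing a segment runs along the vertical line of its
label, with heights unchanged; a vertex widens to the interval spanned by the labels of the objects
through its point; at a bend, pieces are joined horizontally within the row of that bend. It
suffices that labels are distinct and increase from left to right in each grid row.

Such labels exist although "left of in some row" need not be transitive. If s is left of t, t is
left of u, and t has the highest lower end of the three, then all three meet the row of that lower
end. Since segments do not cross, s is left of u there or, if both pairs touch, in the row above
(`LeftOf.trans_at_highest`). Hence the objects can be inserted by increasing lower end: those that
must precede the new one already precede those that must follow it
(`exists_injOn_of_trans_at_highest`).

Planarity is pulled back point by point. Every point P of the new plane has a point Q of the old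
plane such that P on a new piece forces Q onto the old part it comes from, and P is in the box of a
vertex exactly if Q is its point (`IsRowLabelling.exists_corresponds`). A common point of two new
curves therefore yields one of the old curves, and an intersection at a vertex carries back to its
new box. -/

/-- A relation on a finite set that is transitive at every element which is highest among the
three elements involved can be extended to a linear order, given here by integer labels. -/
theorem exists_injOn_of_trans_at_highest {α : Type*} (O : Finset α) (h : α → ℤ)
    (L : α → α → Prop) (irr : ∀ a, ¬ L a a)
    (tr : ∀ a ∈ O, ∀ b ∈ O, ∀ c ∈ O, h a ≤ h b → h c ≤ h b → L a b → L b c → L a c) :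
    ∃ f : α → ℤ, Set.InjOn f O ∧ ∀ a ∈ O, ∀ b ∈ O, L a b → f a < f b := by
  classical
  have key : ∃ g : α → ℚ, Set.InjOn g O ∧ ∀ a ∈ O, ∀ b ∈ O, L a b → g a < g b := by
    induction O using Finset.induction_on_max_value h with
    | empty => exact ⟨fun _ => 0, by simp, by simp⟩
    | insert a s has hmax ih =>
      obtain ⟨g, ginj, gL⟩ := ih fun x hx y hy z hz =>
        tr x (Finset.mem_insert_of_mem hx) y (Finset.mem_insert_of_mem hy) z
          (Finset.mem_insert_of_mem hz)
      -- As `a` is highest so far, transitivity at `a` puts every required predecessor below every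
      -- required successor.
      obtain ⟨m, hm1, hm2⟩ := Order.exists_between_finsets
        (lo := (s.filter (L · a)).image g) (hi := (s.filter (L a ·)).image g) (by
          simp only [Finset.mem_image, Finset.mem_filter]
          rintro _ ⟨x, ⟨hx, hxa⟩, rfl⟩ _ ⟨y, ⟨hy, hay⟩, rfl⟩
          exact gL x hx y hy (tr x (Finset.mem_insert_of_mem hx) a (Finset.mem_insert_self _ _) y
            (Finset.mem_insert_of_mem hy) (hmax x hx) (hmax y hy) hxa hay))
      -- The value `m` may already be taken; `m'` lies strictly between the values up to `m` and
      -- those above it, so it is new.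
      obtain ⟨m', hm1', hm2'⟩ := Order.exists_between_finsets
        (lo := (s.image g).filter (· ≤ m)) (hi := (s.image g).filter (m < ·)) (by
          simp only [Finset.mem_filter]
          rintro x ⟨-, hx⟩ y ⟨-, hy⟩
          exact hx.trans_lt hy)
      have hne : ∀ x ∈ s, g x ≠ m' := by
        intro x hx hxm
        rcases le_or_gt (g x) m with hle | hlt
        · exact absurd (hm1' (g x) (by simp only [Finset.mem_filter]; exact
            ⟨Finset.mem_image_of_mem g hx, hle⟩)) (by simp [hxm])
        · exact absurd (hm2' (g x) (by simp only [Finset.mem_filter]; exact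
            ⟨Finset.mem_image_of_mem g hx, hlt⟩)) (by simp [hxm])
      have hup : ∀ x ∈ s, Function.update g a m' x = g x := fun x hx =>
        Function.update_of_ne (fun e => has (by rwa [e] at hx)) _ _
      refine ⟨Function.update g a m', ?_, ?_⟩
      · intro x hx y hy hxy
        rcases Finset.mem_insert.1 (Finset.mem_coe.1 hx) with rfl | hx' <;>
          rcases Finset.mem_insert.1 (Finset.mem_coe.1 hy) with rfl | hy'
        · rfl
        · rw [Function.update_self, hup y hy'] at hxy
          exact absurd hxy.symm (hne y hy')
        · rw [Function.update_self, hup x hx'] at hxy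
          exact absurd hxy (hne x hx')
        · rw [hup x hx', hup y hy'] at hxy
          exact ginj hx' hy' hxy
      · intro x hx y hy hxy
        rcases Finset.mem_insert.1 hx with rfl | hx' <;>
          rcases Finset.mem_insert.1 hy with rfl | hy'
        · exact absurd hxy (irr _)
        · rw [Function.update_self, hup y hy']
          exact hm2' _ (Finset.mem_filter.2 ⟨Finset.mem_image_of_mem g hy',
            hm2 _ (Finset.mem_image_of_mem g (Finset.mem_filter.2 ⟨hy', hxy⟩))⟩)
        · rw [Function.update_self, hup x hx']
          exact hm1' _ (Finset.mem_filter.2 ⟨Finset.mem_image_of_mem g hx',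
            (hm1 _ (Finset.mem_image_of_mem g (Finset.mem_filter.2 ⟨hx', hxy⟩))).le⟩)
        · rw [hup x hx', hup y hy']
          exact gL x hx' y hy' hxy
  obtain ⟨g, ginj, gL⟩ := key
  -- The integer label is the rank: the number of elements with smaller rational value.
  have mono : ∀ a ∈ O, ∀ b ∈ O, g a < g b →
      (((O.filter (g · < g a)).card : ℕ) : ℤ) < ((O.filter (g · < g b)).card : ℕ) := by
    intro a ha b hb hab
    refine Int.ofNat_lt.2 (Finset.card_lt_card (Finset.ssubset_iff_of_subset ?_ |>.2 ⟨a, ?_, ?_⟩))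
    · intro x hx
      simp only [Finset.mem_filter] at hx ⊢
      exact ⟨hx.1, hx.2.trans hab⟩
    · simp [ha, hab]
    · simp
  refine ⟨fun a => ((O.filter (g · < g a)).card : ℕ), ?_, fun a ha b hb hab =>
    mono a ha b hb (gL a ha b hb hab)⟩
  intro a ha b hb hab
  rcases lt_trichotomy (g a) (g b) with hlt | heq | hgt
  · exact absurd hab (mono a ha b hb hlt).ne
  · exact ginj ha hb heq
  · exact absurd hab (mono b hb a ha hgt).ne'

/-! ### Segments and poly-lines -/

@[simp] theorem GridPt.toPlane_fst (p : GridPt) : p.toPlane.1 = (p.1 : ℝ) := rfl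

@[simp] theorem GridPt.toPlane_snd (p : GridPt) : p.toPlane.2 = (p.2 : ℝ) := rfl

theorem GridPt.toPlane_injective : Function.Injective GridPt.toPlane := by
  intro p q h
  have h1 := congrArg Prod.fst h
  have h2 := congrArg Prod.snd h
  simp only [GridPt.toPlane_fst, GridPt.toPlane_snd, Int.cast_inj] at h1 h2
  exact Prod.ext h1 h2

theorem mem_segment_of_row {a b : GridPt} (h : a.2 = b.2) {P : ℝ × ℝ} :
    P ∈ segment ℝ a.toPlane b.toPlane ↔ P.2 = a.2 ∧ P.1 ∈ Set.uIcc (a.1 : ℝ) b.1 := by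
  have : b.toPlane = ((b.1 : ℝ), (a.2 : ℝ)) := by rw [h]; rfl
  rw [this, show a.toPlane = ((a.1 : ℝ), (a.2 : ℝ)) from rfl, ← Prod.image_mk_segment_left,
    segment_eq_uIcc]
  constructor
  · rintro ⟨x, hx, rfl⟩
    exact ⟨rfl, hx⟩
  · rintro ⟨h1, h2⟩
    exact ⟨P.1, h2, Prod.ext rfl h1.symm⟩

theorem mem_segment_of_column {x y z : ℤ} {P : ℝ × ℝ} :
    P ∈ segment ℝ (GridPt.toPlane (x, y)) (GridPt.toPlane (x, z)) ↔
      P.1 = x ∧ P.2 ∈ Set.uIcc (y : ℝ) z := by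
  rw [show GridPt.toPlane (x, y) = ((x : ℝ), (y : ℝ)) from rfl,
    show GridPt.toPlane (x, z) = ((x : ℝ), (z : ℝ)) from rfl, ← Prod.image_mk_segment_right,
    segment_eq_uIcc]
  constructor
  · rintro ⟨t, ht, rfl⟩
    exact ⟨rfl, ht⟩
  · rintro ⟨h1, h2⟩
    exact ⟨P.2, h2, Prod.ext h1.symm rfl⟩

/-- The `x`-coordinate at height `t` of the line through the two given points. For a point
(a pair of equal points), its `x`-coordinate. -/
noncomputable def xAt (s : GridPt × GridPt) (t : ℝ) : ℝ :=
  s.1.1 + (t - s.1.2) * (((s.2.1 : ℝ) - s.1.1) / ((s.2.2 : ℝ) - s.1.2))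

theorem xAt_self (p : GridPt) (t : ℝ) : xAt (p, p) t = p.1 := by simp [xAt]

theorem xAt_fst (s : GridPt × GridPt) : xAt s s.1.2 = s.1.1 := by simp [xAt]

theorem xAt_snd {s : GridPt × GridPt} (h : s.1.2 < s.2.2) : xAt s s.2.2 = s.2.1 := by
  have : (s.2.2 : ℝ) - s.1.2 ≠ 0 := sub_ne_zero.2 (by exact_mod_cast h.ne')
  rw [xAt, mul_div_cancel₀ _ this]
  ring

theorem mem_segment_of_lt {s : GridPt × GridPt} (h : s.1.2 < s.2.2) {P : ℝ × ℝ} :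
    P ∈ segment ℝ s.1.toPlane s.2.toPlane ↔
      (s.1.2 : ℝ) ≤ P.2 ∧ P.2 ≤ s.2.2 ∧ P.1 = xAt s P.2 := by
  have hpos : (0 : ℝ) < (s.2.2 : ℝ) - s.1.2 := sub_pos.2 (by exact_mod_cast h)
  rw [segment_eq_image]
  constructor
  · rintro ⟨θ, ⟨h0, h1⟩, rfl⟩
    simp only [Prod.snd_add, Prod.smul_snd, GridPt.toPlane_snd, smul_eq_mul, Prod.fst_add,
      Prod.smul_fst, GridPt.toPlane_fst, xAt]
    refine ⟨by nlinarith, by nlinarith, ?_⟩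
    field_simp
    ring
  · rintro ⟨h1, h2, h3⟩
    refine ⟨(P.2 - s.1.2) / (s.2.2 - s.1.2), ⟨div_nonneg (by linarith) hpos.le,
      (div_le_one hpos).2 (by linarith)⟩, Prod.ext ?_ ?_⟩
    · simp only [Prod.fst_add, Prod.smul_fst, GridPt.toPlane_fst, smul_eq_mul, h3, xAt]
      field_simp
      ring
    · simp only [Prod.snd_add, Prod.smul_snd, GridPt.toPlane_snd, smul_eq_mul]
      field_simp
      ring

theorem toPlane_mem_trace (p : GridPt) (l : List GridPt) : p.toPlane ∈ trace (p :: l) := by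
  cases l with
  | nil => rfl
  | cons q l => exact Or.inl (left_mem_segment ℝ _ _)

theorem trace_tail_subset (p : GridPt) (l : List GridPt) : trace l ⊆ trace (p :: l) := by
  cases l with
  | nil => exact Set.empty_subset _
  | cons q l => exact Set.subset_union_right

theorem segment_subset_trace {a b : GridPt} {l : List GridPt} (h : [a, b] <:+: l) :
    segment ℝ a.toPlane b.toPlane ⊆ trace l := by
  induction l with
  | nil => simp at h
  | cons p l ih =>
    rcases List.infix_cons_iff.1 h with h | h
    · obtain ⟨t, ht⟩ := h
      obtain ⟨rfl, rfl⟩ : a = p ∧ b :: t = l := by simpa using ht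
      exact Set.subset_union_left
    · exact (ih h).trans (trace_tail_subset _ _)

theorem NotSelfIntersecting.tail {p : GridPt} {l : List GridPt}
    (h : NotSelfIntersecting (p :: l)) : NotSelfIntersecting l := by
  match l, h with
  | [], _ => trivial
  | [_], _ => trivial
  | _ :: _ :: _, h => exact h.2

theorem ProperBends.tail {p : GridPt} {l : List GridPt} (h : ProperBends (p :: l)) :
    ProperBends l := by
  match l, h with
  | [], _ => trivial
  | [_], _ => trivial
  | _ :: _ :: _, h => exact h.2

theorem NotSelfIntersecting.segment_inter {p q : GridPt} {l : List GridPt}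
    (h : NotSelfIntersecting (p :: q :: l)) :
    segment ℝ p.toPlane q.toPlane ∩ trace (q :: l) ⊆ {q.toPlane} := by
  cases l with
  | nil => exact Set.inter_subset_right
  | cons r l => exact h.1

theorem NotSelfIntersecting.cons {p q : GridPt} {l : List GridPt}
    (h : segment ℝ p.toPlane q.toPlane ∩ trace (q :: l) ⊆ {q.toPlane})
    (hl : NotSelfIntersecting (q :: l)) : NotSelfIntersecting (p :: q :: l) := by
  cases l with
  | nil => trivial
  | cons r l => exact ⟨h, hl⟩

theorem NotSelfIntersecting.head_notMem {p q : GridPt} {l : List GridPt}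
    (h : NotSelfIntersecting (p :: q :: l)) (hpq : p ≠ q) : p.toPlane ∉ trace (q :: l) :=
  fun hp => hpq (GridPt.toPlane_injective (h.segment_inter ⟨left_mem_segment ℝ _ _, hp⟩))

/-- A poly-line that does not intersect itself contains its first corner only as the start of
its first segment. -/
theorem NotSelfIntersecting.eq_head {p : GridPt} {l : List GridPt}
    (h : NotSelfIntersecting (p :: l)) (hl : (p :: l).IsChain (· ≠ ·)) {a b : GridPt}
    (hab : [a, b] <:+: p :: l) (hp : p.toPlane ∈ segment ℝ a.toPlane b.toPlane) : p = a := by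
  rcases List.infix_cons_iff.1 hab with hab | hab
  · obtain ⟨t, ht⟩ := hab
    have : a = p ∧ b :: t = l := by simpa using ht
    exact this.1.symm
  · cases l with
    | nil => simp at hab
    | cons q l =>
      exact absurd (segment_subset_trace hab hp) (h.head_notMem (List.isChain_cons_cons.1 hl).1)

/-- A common point of two distinct segments of a poly-line that does not intersect itself is an
end of one of them. -/
theorem NotSelfIntersecting.mem_ends {l : List GridPt} (h : NotSelfIntersecting l)
    {a b a' b' : GridPt} (hab : [a, b] <:+: l) (hab' : [a', b'] <:+: l) (hne : (a, b) ≠ (a', b'))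
    {P : ℝ × ℝ} (hP : P ∈ segment ℝ a.toPlane b.toPlane)
    (hP' : P ∈ segment ℝ a'.toPlane b'.toPlane) : P = b.toPlane ∨ P = b'.toPlane := by
  induction l with
  | nil => simp at hab
  | cons p l ih =>
    rcases List.infix_cons_iff.1 hab with hs | hs <;>
      rcases List.infix_cons_iff.1 hab' with hs' | hs'
    · obtain ⟨t, ht⟩ := hs
      obtain ⟨t', ht'⟩ := hs'
      obtain ⟨rfl, rfl⟩ : a = p ∧ b :: t = l := by simpa using ht
      have : a' = a ∧ b' = b ∧ t' = t := by simpa using ht'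
      exact absurd (by rw [this.1, this.2.1]) hne
    · obtain ⟨t, ht⟩ := hs
      obtain ⟨rfl, rfl⟩ : a = p ∧ b :: t = l := by simpa using ht
      exact Or.inl (h.segment_inter ⟨hP, segment_subset_trace hs' hP'⟩)
    · obtain ⟨t, ht⟩ := hs'
      obtain ⟨rfl, rfl⟩ : a' = p ∧ b' :: t = l := by simpa using ht
      exact Or.inr (h.segment_inter ⟨hP', segment_subset_trace hs hP⟩)
    · exact ih h.tail hs hs'

/-- A repeated corner makes both products in the bend condition vanish. At least three corners are
needed, since otherwise there is no such condition. -/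
theorem ProperBends.isChain_ne {p q r : GridPt} {l : List GridPt}
    (h : ProperBends (p :: q :: r :: l)) : (p :: q :: r :: l).IsChain (· ≠ ·) := by
  induction l generalizing p q r with
  | nil =>
    have h1 : (q.1 - p.1) * (r.2 - q.2) ≠ (q.2 - p.2) * (r.1 - q.1) := h.1
    simp only [List.isChain_cons_cons, List.isChain_singleton, and_true]
    constructor <;> rintro rfl <;> simp at h1
  | cons t l ih =>
    refine List.isChain_cons_cons.2 ⟨?_, ih h.tail⟩
    have h1 := h.1
    rintro rfl
    simp at h1

end GraphDrawing

namespace GraphDrawing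

/-! ### The left-to-right order of non-crossing segments -/

/-- The segment from `s.1` up to `s.2` meets the grid row `k`. -/
def MeetsRow (s : GridPt × GridPt) (k : ℤ) : Prop := s.1.2 ≤ k ∧ k ≤ s.2.2

/-- In some grid row the segment `s` is to the left of the segment `t`. -/
def LeftOf (s t : GridPt × GridPt) : Prop :=
  ∃ k : ℤ, MeetsRow s k ∧ MeetsRow t k ∧ xAt s k < xAt t k

/-- The segments `s` and `t` have no common point in the interior of both. -/
def NonCrossing (s t : GridPt × GridPt) : Prop :=
  ∀ y : ℝ, (s.1.2 : ℝ) < y → y < s.2.2 → (t.1.2 : ℝ) < y → y < t.2.2 → xAt s y ≠ xAt t y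

/-- The segment `s` contains the grid point `p`. -/
def Through (s : GridPt × GridPt) (p : GridPt) : Prop := MeetsRow s p.2 ∧ xAt s p.2 = p.1

theorem xAt_combination (s : GridPt × GridPt) (w y z : ℝ) :
    xAt s (w * y + (1 - w) * z) = w * xAt s y + (1 - w) * xAt s z := by
  simp only [xAt]
  ring

/-- The difference of the two positions is affine in the height, so a change of sign would produce a
zero strictly between the rows, in the interior of both segments. -/
theorem NonCrossing.le_of_lt {s t : GridPt × GridPt} (h : NonCrossing s t) {j k : ℤ}
    (hsj : MeetsRow s j) (htj : MeetsRow t j) (hsk : MeetsRow s k) (htk : MeetsRow t k)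
    (hj : xAt s j < xAt t j) : xAt s k ≤ xAt t k := by
  by_contra! hk
  have hD : 0 < (xAt s k - xAt t k) + (xAt t j - xAt s j) := by linarith
  -- The weight at which the affine difference vanishes, at height `w * k + (1 - w) * j`.
  set w := (xAt t j - xAt s j) / ((xAt s k - xAt t k) + (xAt t j - xAt s j)) with hw
  have hw0 : 0 < w := div_pos (by linarith) hD
  have hw1 : w < 1 := (div_lt_one hD).2 (by linarith)
  have hwD : w * ((xAt s k - xAt t k) + (xAt t j - xAt s j)) = xAt t j - xAt s j :=
    div_mul_cancel₀ _ hD.ne'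
  have hne : j ≠ k := by
    rintro rfl
    linarith
  have lower : ∀ m : ℤ, m ≤ j → m ≤ k → (m : ℝ) < w * k + (1 - w) * j := by
    intro m hmj hmk
    have h1 : (m : ℝ) ≤ j := by exact_mod_cast hmj
    have h2 : (m : ℝ) ≤ k := by exact_mod_cast hmk
    rcases lt_or_gt_of_ne hne with hlt | hlt
    · have h3 : (j : ℝ) < k := by exact_mod_cast hlt
      nlinarith
    · have h3 : (k : ℝ) < j := by exact_mod_cast hlt
      nlinarith
  have upper : ∀ m : ℤ, j ≤ m → k ≤ m → w * k + (1 - w) * j < (m : ℝ) := by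
    intro m hmj hmk
    have h1 : (j : ℝ) ≤ m := by exact_mod_cast hmj
    have h2 : (k : ℝ) ≤ m := by exact_mod_cast hmk
    rcases lt_or_gt_of_ne hne with hlt | hlt
    · have h3 : (j : ℝ) < k := by exact_mod_cast hlt
      nlinarith
    · have h3 : (k : ℝ) < j := by exact_mod_cast hlt
      nlinarith
  refine h (w * k + (1 - w) * j) (lower _ hsj.1 hsk.1) (upper _ hsj.2 hsk.2) (lower _ htj.1 htk.1)
    (upper _ htj.2 htk.2) ?_
  rw [xAt_combination, xAt_combination]
  linarith

/-- If `s` is left of `t` in row `j`, then also in each lower row `k` that both meet, or else they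
have a common point in row `k`, and `s` is left of `t` in the row above. -/
theorem NonCrossing.lt_or_eq {s t : GridPt × GridPt} (h : NonCrossing s t) {j k : ℤ}
    (hsj : MeetsRow s j) (htj : MeetsRow t j) (hsk : MeetsRow s k) (htk : MeetsRow t k)
    (hkj : k ≤ j) (hj : xAt s j < xAt t j) :
    xAt s k < xAt t k ∨ xAt s k = xAt t k ∧ MeetsRow s (k + 1) ∧ MeetsRow t (k + 1) ∧
      xAt s ((k + 1 : ℤ) : ℝ) < xAt t ((k + 1 : ℤ) : ℝ) := by
  refine (h.le_of_lt hsj htj hsk htk hj).lt_or_eq.imp id fun heq => ⟨heq, ?_⟩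
  have hlt : k < j := lt_of_le_of_ne hkj (by rintro rfl; exact hj.ne heq)
  refine ⟨⟨by linarith [hsk.1], by linarith [hsj.2]⟩, ⟨by linarith [htk.1], by linarith [htj.2]⟩,
    ?_⟩
  have hpos : (0 : ℝ) < (j : ℝ) - k := sub_pos.2 (by exact_mod_cast hlt)
  -- Row `k + 1` is a convex combination of rows `k` and `j` with weight `1 / (j - k)` on `j`; after
  -- a tie in row `k`, a positive multiple of the gap in row `j` remains.
  have hcomb : ((k + 1 : ℤ) : ℝ) = (1 - 1 / ((j : ℝ) - k)) * k + (1 - (1 - 1 / ((j : ℝ) - k))) * j := by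
    push_cast
    field_simp
    ring
  rw [hcomb, xAt_combination, xAt_combination, heq]
  have : 0 < 1 / ((j : ℝ) - k) := one_div_pos.2 hpos
  nlinarith

/-- All three segments meet the row of the lower end of `t`, where the order is weakly correct. One
strict inequality settles it; if both are ties, all three reach the next row and both inequalities
are strict there. -/
theorem LeftOf.trans_at_highest {s t u : GridPt × GridPt} (hst : NonCrossing s t)
    (htu : NonCrossing t u) (hs : s.1.2 ≤ t.1.2) (hu : u.1.2 ≤ t.1.2) (h : LeftOf s t)
    (h' : LeftOf t u) : LeftOf s u := by
  obtain ⟨j, hsj, htj, hj⟩ := h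
  obtain ⟨i, hti, hui, hi⟩ := h'
  have htk : MeetsRow t t.1.2 := ⟨le_rfl, htj.1.trans htj.2⟩
  have hsk : MeetsRow s t.1.2 := ⟨hs, htj.1.trans hsj.2⟩
  have huk : MeetsRow u t.1.2 := ⟨hu, hti.1.trans hui.2⟩
  rcases hst.lt_or_eq hsj htj hsk htk htj.1 hj with h1 | ⟨h1, hs1, ht1, h1'⟩ <;>
    rcases htu.lt_or_eq hti hui htk huk hti.1 hi with h2 | ⟨h2, ht2, hu2, h2'⟩
  · exact ⟨_, hsk, huk, h1.trans h2⟩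
  · exact ⟨_, hsk, huk, h1.trans_eq h2⟩
  · exact ⟨_, hsk, huk, h1.trans_lt h2⟩
  · exact ⟨_, hs1, hu2, h1'.trans h2'⟩

/-- Integer labels of the members of a finite set of segments that increase from left to right
in each grid row. -/
structure IsRowLabelling (O : Set (GridPt × GridPt)) (f : GridPt × GridPt → ℤ) : Prop where
  finite : O.Finite
  lt_or_point : ∀ s ∈ O, s.1.2 < s.2.2 ∨ s.1 = s.2
  injOn : Set.InjOn f O
  lt_of_leftOf : ∀ s ∈ O, ∀ t ∈ O, LeftOf s t → f s < f t

theorem exists_isRowLabelling {O : Set (GridPt × GridPt)} (hfin : O.Finite)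
    (hO : ∀ s ∈ O, s.1.2 < s.2.2 ∨ s.1 = s.2)
    (hnc : ∀ s ∈ O, ∀ t ∈ O, s ≠ t → NonCrossing s t) : ∃ f, IsRowLabelling O f := by
  have irr : ∀ s, ¬ LeftOf s s := fun s ⟨_, _, _, h⟩ => lt_irrefl _ h
  obtain ⟨f, finj, hf⟩ := exists_injOn_of_trans_at_highest hfin.toFinset (fun s => s.1.2) LeftOf
    irr (by
      intro s hs t ht u hu h1 h2 hst htu
      rw [Set.Finite.mem_toFinset] at hs ht hu
      exact hst.trans_at_highest (hnc s hs t ht (by rintro rfl; exact irr _ hst))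
        (hnc t ht u hu (by rintro rfl; exact irr _ htu)) h1 h2 htu)
  refine ⟨f, hfin, hO, by simpa using finj, fun s hs t ht => hf s (by simpa using hs) t
    (by simpa using ht)⟩

/-! ### Footprints, and the map from the new plane to the old one -/

/-- The labels of the segments that contain the grid point `p`. -/
def footprint (O : Set (GridPt × GridPt)) (f : GridPt × GridPt → ℤ) (p : GridPt) : Set ℤ :=
  f '' {s | s ∈ O ∧ Through s p}

variable {O : Set (GridPt × GridPt)} {f : GridPt × GridPt → ℤ}

theorem mem_footprint {s : GridPt × GridPt} {p : GridPt} (hs : s ∈ O) (h : Through s p) :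
    f s ∈ footprint O f p := ⟨s, ⟨hs, h⟩, rfl⟩

namespace IsRowLabelling

variable (H : IsRowLabelling O f)
include H

/-- The common row of `c` and `e` witnesses that each segment through `c` is left of each segment
through `e`. -/
theorem footprint_lt {c e : GridPt} (hrow : c.2 = e.2) (hlt : c.1 < e.1) {a b : ℤ}
    (ha : a ∈ footprint O f c) (hb : b ∈ footprint O f e) : a < b := by
  obtain ⟨s, ⟨hs, hsc⟩, rfl⟩ := ha
  obtain ⟨t, ⟨ht, hte⟩, rfl⟩ := hb
  refine H.lt_of_leftOf s hs t ht ⟨c.2, hsc.1, hrow ▸ hte.1, ?_⟩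
  rw [hsc.2, hrow, hte.2]
  exact_mod_cast hlt

theorem footprint_ne {c e : GridPt} (hrow : c.2 = e.2) (hne : c ≠ e) {a b : ℤ}
    (ha : a ∈ footprint O f c) (hb : b ∈ footprint O f e) : a ≠ b := by
  rcases lt_trichotomy c.1 e.1 with h | h | h
  · exact (H.footprint_lt hrow h ha hb).ne
  · exact absurd (Prod.ext h hrow) hne
  · exact (H.footprint_lt hrow.symm h hb ha).ne'

theorem finite_footprint (p : GridPt) : (footprint O f p).Finite :=
  (H.finite.subset fun _ h => h.1).image f

theorem sInf_mem {p : GridPt} (hp : (footprint O f p).Nonempty) :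
    sInf (footprint O f p) ∈ footprint O f p := Int.csInf_mem hp (H.finite_footprint p).bddBelow

theorem sSup_mem {p : GridPt} (hp : (footprint O f p).Nonempty) :
    sSup (footprint O f p) ∈ footprint O f p := Int.csSup_mem hp (H.finite_footprint p).bddAbove

theorem sInf_le {p : GridPt} {a : ℤ} (ha : a ∈ footprint O f p) : sInf (footprint O f p) ≤ a :=
  csInf_le (H.finite_footprint p).bddBelow ha

theorem le_sSup {p : GridPt} {a : ℤ} (ha : a ∈ footprint O f p) : a ≤ sSup (footprint O f p) :=
  le_csSup (H.finite_footprint p).bddAbove ha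

/-- Each position `z` among the labels in row `k` corresponds to a position `x` among the
segments in row `k`. -/
theorem exists_position (k : ℤ) (z : ℝ) :
    ∃ x : ℝ, (∀ s ∈ O, MeetsRow s k → (x < xAt s k → z < f s) ∧ (xAt s k < x → f s < z)) ∧
      ∀ s ∈ O, MeetsRow s k → xAt s k = x → ∃ t ∈ O, ∃ u ∈ O, MeetsRow t k ∧ MeetsRow u k ∧
        xAt t k = x ∧ xAt u k = x ∧ (f t : ℝ) ≤ z ∧ z ≤ f u := by
  classical
  -- If `z` lies in the label interval of some point of the row, that point is the position.
  -- Otherwise labels up to `z` belong to segments strictly left of those with labels from `z` on;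
  -- `x` is chosen in this gap, so no segment passes through it.
  by_cases hc : ∃ t ∈ O, ∃ u ∈ O, MeetsRow t k ∧ MeetsRow u k ∧ xAt u k = xAt t k ∧
      (f t : ℝ) ≤ z ∧ z ≤ f u
  · obtain ⟨t, ht, u, hu, htk, huk, hut, htz, hzu⟩ := hc
    refine ⟨xAt t k, fun s hs hsk => ⟨fun h => ?_, fun h => ?_⟩, fun s _ _ _ =>
      ⟨t, ht, u, hu, htk, huk, rfl, hut, htz, hzu⟩⟩
    · refine hzu.trans_lt (Int.cast_lt.2 (H.lt_of_leftOf u hu s hs ⟨k, huk, hsk, ?_⟩))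
      rwa [hut]
    · exact (Int.cast_lt.2 (H.lt_of_leftOf s hs t ht ⟨k, hsk, htk, h⟩)).trans_le htz
  · have hpos : ∀ s ∈ O, ∀ t ∈ O, MeetsRow s k → MeetsRow t k → (f s : ℝ) ≤ z → z ≤ f t →
        xAt s k < xAt t k := by
      intro s hs t ht hsk htk hsz hzt
      rcases lt_trichotomy (xAt s k) (xAt t k) with h | h | h
      · exact h
      · exact absurd ⟨s, hs, t, ht, hsk, htk, h.symm, hsz, hzt⟩ hc
      · have h1 : (f t : ℝ) < f s :=
          Int.cast_lt.2 (H.lt_of_leftOf t ht s hs ⟨k, htk, hsk, h⟩)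
        linarith
    obtain ⟨x, hlo, hhi⟩ := Order.exists_between_finsets
      (lo := (H.finite.toFinset.filter fun s => MeetsRow s k ∧ (f s : ℝ) ≤ z).image (xAt · k))
      (hi := (H.finite.toFinset.filter fun s => MeetsRow s k ∧ z ≤ (f s : ℝ)).image (xAt · k)) (by
        simp only [Finset.mem_image, Finset.mem_filter, Set.Finite.mem_toFinset]
        rintro _ ⟨s, ⟨hs, hsk, hsz⟩, rfl⟩ _ ⟨t, ⟨ht, htk, hzt⟩, rfl⟩
        exact hpos s hs t ht hsk htk hsz hzt)
    have lo' : ∀ s ∈ O, MeetsRow s k → (f s : ℝ) ≤ z → xAt s k < x := fun s hs hsk hsz =>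
      hlo _ (Finset.mem_image_of_mem (xAt · k)
        (Finset.mem_filter.2 ⟨H.finite.mem_toFinset.2 hs, hsk, hsz⟩))
    have hi' : ∀ s ∈ O, MeetsRow s k → z ≤ (f s : ℝ) → x < xAt s k := fun s hs hsk hsz =>
      hhi _ (Finset.mem_image_of_mem (xAt · k)
        (Finset.mem_filter.2 ⟨H.finite.mem_toFinset.2 hs, hsk, hsz⟩))
    refine ⟨x, fun s hs hsk => ⟨fun h => ?_, fun h => ?_⟩, fun s hs hsk hsx => ?_⟩
    · by_contra! hle
      exact absurd (lo' s hs hsk hle) h.not_gt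
    · by_contra! hle
      exact absurd (hi' s hs hsk hle) h.not_gt
    · rcases le_total (f s : ℝ) z with h | h
      · exact absurd hsx (lo' s hs hsk h).ne
      · exact absurd hsx (hi' s hs hsk h).ne'

end IsRowLabelling

/-- The point `Q` of the old plane corresponds to the point `P` of the new plane, where each
segment `s ∈ O` is drawn on the vertical line of its label. -/
structure Corresponds (O : Set (GridPt × GridPt)) (f : GridPt × GridPt → ℤ) (P Q : ℝ × ℝ) :
    Prop where
  snd_eq : Q.2 = P.2
  row : ∀ {a b c e : GridPt}, a.1 ∈ footprint O f c → a.2 = c.2 → b.1 ∈ footprint O f e →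
    b.2 = e.2 → c.2 = e.2 → P ∈ segment ℝ a.toPlane b.toPlane → Q ∈ segment ℝ c.toPlane e.toPlane
  column : ∀ s ∈ O, s.1.2 < s.2.2 → P.1 = f s → (s.1.2 : ℝ) ≤ P.2 → P.2 ≤ s.2.2 →
    Q ∈ segment ℝ s.1.toPlane s.2.toPlane
  eq_iff : ∀ p : GridPt, (footprint O f p).Nonempty → (Q = p.toPlane ↔
    P.2 = p.2 ∧ ((sInf (footprint O f p) : ℤ) : ℝ) ≤ P.1 ∧ P.1 ≤ ((sSup (footprint O f p) : ℤ) : ℝ))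

/-- Only incidences have to be preserved, so `Q` is chosen separately for each `P`, with no
continuity. -/
theorem IsRowLabelling.exists_corresponds (H : IsRowLabelling O f) (P : ℝ × ℝ) :
    ∃ Q, Corresponds O f P Q := by
  -- Grid rows use `exists_position`. Between them only the vertical pieces matter, and by
  -- injectivity at most one segment has the label `P.1`.
  by_cases hint : ∃ k : ℤ, P.2 = k
  · obtain ⟨k, hk⟩ := hint
    obtain ⟨x, hx, hx'⟩ := H.exists_position k P.1
    have left : ∀ p : GridPt, p.2 = k → x < p.1 → ∀ a ∈ footprint O f p, P.1 < a := by
      rintro p rfl hxp _ ⟨s, ⟨hs, hsp⟩, rfl⟩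
      exact (hx s hs hsp.1).1 (by rwa [hsp.2])
    have right : ∀ p : GridPt, p.2 = k → p.1 < x → ∀ a ∈ footprint O f p, a < P.1 := by
      rintro p rfl hxp _ ⟨s, ⟨hs, hsp⟩, rfl⟩
      exact (hx s hs hsp.1).2 (by rwa [hsp.2])
    refine ⟨(x, k), hk.symm, ?_, ?_, ?_⟩
    · intro a b c e ha hac hb hbe hce hP
      rw [mem_segment_of_row (hac.trans (hce.trans hbe.symm))] at hP
      have hck : c.2 = k := by
        rw [hac, hk] at hP
        exact_mod_cast hP.1.symm
      rw [mem_segment_of_row hce]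
      refine ⟨by simp [hck], ?_⟩
      obtain ⟨-, h1, h2⟩ := hP
      constructor
      · by_contra! hlt
        obtain ⟨hc, he⟩ := lt_min_iff.1 hlt
        exact absurd h1 (lt_min (left c hck hc _ ha) (left e (hce ▸ hck) he _ hb)).not_ge
      · by_contra! hlt
        obtain ⟨hc, he⟩ := max_lt_iff.1 hlt
        exact absurd h2 (max_lt (right c hck hc _ ha) (right e (hce ▸ hck) he _ hb)).not_ge
    · intro s hs hlt hP h1 h2
      rw [hk] at h1 h2
      rw [mem_segment_of_lt hlt]
      refine ⟨h1, h2, ?_⟩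
      have hsk : MeetsRow s k := ⟨by exact_mod_cast h1, by exact_mod_cast h2⟩
      rcases lt_trichotomy x (xAt s k) with h | h | h
      · exact absurd hP ((hx s hs hsk).1 h).ne
      · exact h
      · exact absurd hP ((hx s hs hsk).2 h).ne'
    · intro p hp
      constructor
      · intro hQ
        have h1 : x = p.1 := congrArg Prod.fst hQ
        have h2 : k = p.2 := by
          have : (k : ℝ) = p.2 := congrArg Prod.snd hQ
          exact_mod_cast this
        subst h2
        obtain ⟨_, s, ⟨hs, hsp⟩, -⟩ := hp
        obtain ⟨t, ht, u, hu, htk, huk, htx, hux, htP, hPu⟩ :=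
          hx' s hs hsp.1 (by rw [hsp.2, h1])
        refine ⟨hk, le_trans ?_ htP, hPu.trans ?_⟩
        · exact_mod_cast H.sInf_le (mem_footprint ht ⟨htk, by rw [htx, h1]⟩)
        · exact_mod_cast H.le_sSup (mem_footprint hu ⟨huk, by rw [hux, h1]⟩)
      · rintro ⟨h1, h2, h3⟩
        have hpk : p.2 = k := by
          rw [hk] at h1
          exact_mod_cast h1.symm
        refine Prod.ext ?_ (by simp [hpk])
        rcases lt_trichotomy x p.1 with h | h | h
        · exact absurd h2 (left p hpk h _ (H.sInf_mem hp)).not_ge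
        · exact h
        · exact absurd h3 (right p hpk h _ (H.sSup_mem hp)).not_ge
  · have hcol : ∃ x : ℝ, ∀ s ∈ O, P.1 = f s → x = xAt s P.2 := by
      by_cases hs : ∃ s ∈ O, P.1 = f s
      · obtain ⟨s, hs, hsP⟩ := hs
        refine ⟨xAt s P.2, fun t ht htP => ?_⟩
        rw [H.injOn hs ht (by exact_mod_cast hsP.symm.trans htP)]
      · exact ⟨0, fun s h h' => absurd ⟨s, h, h'⟩ hs⟩
    obtain ⟨x, hx⟩ := hcol
    refine ⟨(x, P.2), rfl, ?_, ?_, ?_⟩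
    · intro a b c e _ hac _ hbe hce hP
      rw [mem_segment_of_row (hac.trans (hce.trans hbe.symm))] at hP
      exact absurd ⟨_, hP.1⟩ hint
    · intro s hs hlt hP h1 h2
      rw [mem_segment_of_lt hlt]
      exact ⟨h1, h2, hx s hs hP⟩
    · intro p _
      exact ⟨fun h => absurd ⟨_, congrArg Prod.snd h⟩ hint, fun h => absurd ⟨_, h.1⟩ hint⟩

end GraphDrawing

namespace GraphDrawing

/-! ### The orthogonal poly-line that replaces a poly-line -/

/-- The segment between `p` and `q`, directed upwards. -/
def upward (p q : GridPt) : GridPt × GridPt := if p.2 < q.2 then (p, q) else (q, p)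

theorem upward_comm {p q : GridPt} (h : p.2 ≠ q.2) : upward p q = upward q p := by
  unfold upward
  rcases lt_or_gt_of_ne h with h | h <;> simp [h, h.not_gt]

theorem upward_lt {p q : GridPt} (h : p.2 ≠ q.2) : (upward p q).1.2 < (upward p q).2.2 := by
  unfold upward
  rcases lt_or_gt_of_ne h with h | h <;> simp [h, h.not_gt]

theorem through_upward_left {p q : GridPt} (h : p.2 ≠ q.2) : Through (upward p q) p := by
  unfold upward
  rcases lt_or_gt_of_ne h with h | h
  · rw [if_pos h]
    exact ⟨⟨le_rfl, h.le⟩, xAt_fst (p, q)⟩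
  · rw [if_neg h.not_gt]
    exact ⟨⟨h.le, le_rfl⟩, xAt_snd (s := (q, p)) h⟩

theorem through_upward_right {p q : GridPt} (h : p.2 ≠ q.2) : Through (upward p q) q :=
  upward_comm h ▸ through_upward_left h.symm

theorem through_self (p : GridPt) : Through (p, p) p := ⟨⟨le_rfl, le_rfl⟩, xAt_self _ _⟩

theorem upward_ne {p q r : GridPt} (hpq : p.2 ≠ q.2) (hpr : p ≠ r) :
    upward p q ≠ upward q r := by
  have hpq' : p ≠ q := fun h => hpq (by rw [h])
  intro h
  unfold upward at h
  split_ifs at h <;> rw [Prod.mk.injEq] at h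
  · exact hpq' h.1
  · exact hpr h.1
  · exact hpr h.2
  · exact hpq' h.2

theorem Through.eq {s : GridPt × GridPt} {p q : GridPt} (hp : Through s p) (hq : Through s q)
    (h : p.2 = q.2) : p = q := by
  refine Prod.ext ?_ h
  have h1 := hp.2
  rw [h, hq.2] at h1
  exact_mod_cast h1.symm

variable (O : Set (GridPt × GridPt)) (f : GridPt × GridPt → ℤ)

/-- The new attachment point at `p` of an edge that starts with the segment from `p` to `q`. -/
noncomputable def attachment (p q : GridPt) : GridPt :=
  (if p.2 = q.2 then
    if p.1 < q.1 then sSup (footprint O f p) else sInf (footprint O f p)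
  else f (upward p q), p.2)

/-- The corner in the row of `p` of the vertical segment that replaces the segment from `p`
to `q`. There is none if that segment is horizontal. -/
def corner (p q : GridPt) : List GridPt := if p.2 = q.2 then [] else [(f (upward p q), p.2)]

/-- The new bends that replace the bends of a poly-line. -/
def bendGroups : List GridPt → List (List GridPt)
  | p :: q :: r :: l => (corner f q p ++ corner f q r) :: bendGroups (q :: r :: l)
  | _ => []

/-- The new attachment point at the start of a poly-line. -/
noncomputable def startCorner : List GridPt → List GridPt
  | p :: q :: _ => [attachment O f p q]
  | _ => []

/-- The orthogonal poly-line that replaces a poly-line. -/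
noncomputable def orthogonalPath (l : List GridPt) : List GridPt :=
  startCorner O f l ++ ((bendGroups f l).flatten ++ startCorner O f l.reverse)

/-- The corners of the new poly-line, without the first one if it starts with a horizontal
segment. -/
noncomputable def laterCorners : List GridPt → List GridPt
  | p :: q :: r :: l => corner f p q ++ (corner f q p ++ laterCorners (q :: r :: l))
  | [p, q] => corner f p q ++ [attachment O f q p]
  | _ => []

theorem attachment_snd (p q : GridPt) : (attachment O f p q).2 = p.2 := rfl

theorem attachment_of_ne {p q : GridPt} (h : p.2 ≠ q.2) :
    attachment O f p q = (f (upward p q), p.2) := by simp [attachment, h]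

theorem snd_eq_of_mem_corner {p q x : GridPt} (h : x ∈ corner f p q) : x.2 = p.2 := by
  unfold corner at h
  split_ifs at h
  · simp at h
  · rw [List.mem_singleton.1 h]

theorem corner_reverse (p q : GridPt) : (corner f p q).reverse = corner f p q := by
  unfold corner
  split_ifs <;> rfl

theorem laterCorners_of_ne {p q : GridPt} (l : List GridPt) (h : p.2 ≠ q.2) :
    laterCorners O f (p :: q :: l) =
      (f (upward p q), p.2) :: (f (upward p q), q.2) :: laterCorners O f (q :: l) := by
  cases l with
  | nil => simp [laterCorners, corner, h, attachment_of_ne O f h.symm, upward_comm h]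
  | cons r l => simp [laterCorners, corner, h, h.symm, upward_comm h]

theorem laterCorners_of_eq {p q r : GridPt} (l : List GridPt) (h : p.2 = q.2) :
    laterCorners O f (p :: q :: r :: l) = laterCorners O f (q :: r :: l) := by
  simp [laterCorners, corner, h]

theorem laterCorners_pair_of_eq {p q : GridPt} (h : p.2 = q.2) :
    laterCorners O f [p, q] = [attachment O f q p] := by
  simp [laterCorners, corner, h]

theorem startCorner_reverse_cons (p q r : GridPt) (l : List GridPt) :
    startCorner O f (p :: q :: r :: l).reverse = startCorner O f (q :: r :: l).reverse := by
  rw [List.reverse_cons (a := p)]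
  rcases h : (q :: r :: l).reverse with _ | ⟨x, _ | ⟨y, m⟩⟩
  · simp at h
  · simpa using congrArg List.length h
  · rfl

/-- Links the two descriptions: the symmetric one suits reversal and the grouping of bends, the
recursive one suits induction along the edge. -/
theorem laterCorners_eq (p q : GridPt) (l : List GridPt) :
    laterCorners O f (p :: q :: l) = corner f p q ++
      ((bendGroups f (p :: q :: l)).flatten ++ startCorner O f (p :: q :: l).reverse) := by
  induction l generalizing p q with
  | nil => simp [laterCorners, bendGroups, startCorner]
  | cons r l ih =>
    rw [startCorner_reverse_cons]
    simp only [laterCorners, bendGroups, ih, List.flatten_cons, List.append_assoc]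

theorem orthogonalPath_of_eq {p q : GridPt} (l : List GridPt) (h : p.2 = q.2) :
    orthogonalPath O f (p :: q :: l) =
      attachment O f p q :: laterCorners O f (p :: q :: l) := by
  rw [laterCorners_eq, orthogonalPath, corner, if_pos h]
  rfl

theorem orthogonalPath_of_ne {p q : GridPt} (l : List GridPt) (h : p.2 ≠ q.2) :
    orthogonalPath O f (p :: q :: l) = laterCorners O f (p :: q :: l) := by
  rw [laterCorners_eq, orthogonalPath, corner, if_neg h, startCorner, attachment_of_ne O f h]

/-- Appending `p` adds just the group of the bend at `q`, which depends on the two neighbours of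
`q`; `l.reverse.take 1` is its predecessor, if any. -/
theorem bendGroups_append (p q : GridPt) (l : List GridPt) :
    bendGroups f (l ++ [q, p]) = bendGroups f (l ++ [q]) ++ bendGroups f (l.reverse.take 1 ++ [q, p]) := by
  induction l with
  | nil => rfl
  | cons x l ih =>
    rcases l with _ | ⟨y, _ | ⟨z, l⟩⟩
    · rfl
    · rfl
    · have : ∀ m : List GridPt, bendGroups f (x :: y :: z :: l ++ m) =
          (corner f y x ++ corner f y z) :: bendGroups f (y :: z :: l ++ m) := fun _ => rfl
      rw [this, this, ih, List.cons_append]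
      congr 3
      rw [List.reverse_cons (a := x), List.take_append_of_le_length (by simp)]

theorem bendGroups_reverse (l : List GridPt) :
    bendGroups f l.reverse = ((bendGroups f l).map List.reverse).reverse := by
  induction l with
  | nil => rfl
  | cons p l ih =>
    rcases l with _ | ⟨q, _ | ⟨r, l⟩⟩
    · rfl
    · rfl
    · rw [List.reverse_cons, List.reverse_cons, List.append_assoc, List.singleton_append,
        bendGroups_append, ← List.reverse_cons, ih]
      simp [bendGroups, corner_reverse]

theorem startCorner_reverse (l : List GridPt) : (startCorner O f l).reverse = startCorner O f l := by
  rcases l with _ | ⟨q, _ | ⟨r, l⟩⟩ <;> rfl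

theorem orthogonalPath_reverse (l : List GridPt) :
    orthogonalPath O f l.reverse = (orthogonalPath O f l).reverse := by
  simp [orthogonalPath, startCorner_reverse, bendGroups_reverse, List.reverse_flatten]

theorem orthogonalPath_bends (p q : GridPt) (l : List GridPt) :
    (orthogonalPath O f (p :: q :: l)).tail.dropLast = (bendGroups f (p :: q :: l)).flatten := by
  rcases h : (p :: q :: l).reverse with _ | ⟨x, _ | ⟨y, m⟩⟩
  · simp at h
  · simpa using congrArg List.length h
  · rw [orthogonalPath, h]
    simp [startCorner]

theorem forall₂_bendGroups (p : GridPt) (l : List GridPt) :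
    List.Forall₂ (fun (b : GridPt) (g : List GridPt) => ∀ x ∈ g, x.2 = b.2) l.dropLast
      (bendGroups f (p :: l)) := by
  induction l generalizing p with
  | nil => exact List.Forall₂.nil
  | cons q l ih =>
    cases l with
    | nil => exact List.Forall₂.nil
    | cons r l =>
      refine List.Forall₂.cons (fun x hx => ?_) (ih q)
      rcases List.mem_append.1 hx with hx | hx <;> exact snd_eq_of_mem_corner f hx

/-! ### Orthogonality and monotonicity of the new poly-lines -/

theorem isChain_laterCorners (a p : GridPt) (l : List GridPt) (ha : a.2 = p.2) :
    (a :: laterCorners O f (p :: l)).IsChain (fun x y => x.1 = y.1 ∨ x.2 = y.2) := by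
  induction l generalizing a p with
  | nil => exact List.IsChain.singleton _
  | cons q l ih =>
    by_cases h : p.2 = q.2
    · cases l with
      | nil =>
        rw [laterCorners_pair_of_eq O f h]
        simp [attachment_snd, ha, h]
      | cons r l =>
        rw [laterCorners_of_eq O f l h]
        exact ih a q (ha.trans h)
    · rw [laterCorners_of_ne O f l h]
      exact List.isChain_cons_cons.2 ⟨Or.inr ha, List.isChain_cons_cons.2 ⟨Or.inl rfl, ih _ q rfl⟩⟩

theorem isChain_orthogonalPath (p q : GridPt) (l : List GridPt) :
    (orthogonalPath O f (p :: q :: l)).IsChain (fun x y => x.1 = y.1 ∨ x.2 = y.2) := by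
  by_cases h : p.2 = q.2
  · rw [orthogonalPath_of_eq O f l h]
    exact isChain_laterCorners O f _ p _ rfl
  · rw [orthogonalPath_of_ne O f l h]
    exact (isChain_laterCorners O f p p (q :: l) rfl).of_cons

theorem exists_snd_eq_of_mem_laterCorners {x : GridPt} {l : List GridPt}
    (hx : x ∈ laterCorners O f l) : ∃ b ∈ l, x.2 = b.2 := by
  match l with
  | [] => simp [laterCorners] at hx
  | [p] => simp [laterCorners] at hx
  | [p, q] =>
    rcases List.mem_append.1 hx with hx | hx
    · exact ⟨p, by simp, snd_eq_of_mem_corner f hx⟩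
    · exact ⟨q, by simp, by rw [List.mem_singleton.1 hx]; rfl⟩
  | p :: q :: r :: l =>
    rcases List.mem_append.1 hx with hx | hx
    · exact ⟨p, by simp, snd_eq_of_mem_corner f hx⟩
    rcases List.mem_append.1 hx with hx | hx
    · exact ⟨q, by simp, snd_eq_of_mem_corner f hx⟩
    · obtain ⟨b, hb, h⟩ := exists_snd_eq_of_mem_laterCorners hx
      exact ⟨b, List.mem_cons_of_mem _ hb, h⟩

/-- New corners inherit the heights of old ones in the same order; reflexivity covers several
corners at one bend. The relation is abstract to serve both directions of monotonicity. -/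
theorem pairwise_laterCorners {R : ℤ → ℤ → Prop} [Std.Refl R] {l : List GridPt}
    (hl : l.Pairwise (fun p q => R p.2 q.2)) :
    (laterCorners O f l).Pairwise (fun p q => R p.2 q.2) := by
  induction l with
  | nil => exact List.Pairwise.nil
  | cons p l ih =>
    obtain ⟨hp, hl⟩ := List.pairwise_cons.1 hl
    cases l with
    | nil => exact List.Pairwise.nil
    | cons q l =>
      by_cases h : p.2 = q.2
      · cases l with
        | nil =>
          rw [laterCorners_pair_of_eq O f h]
          exact List.pairwise_singleton _ _
        | cons r l =>
          rw [laterCorners_of_eq O f l h]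
          exact ih hl
      · rw [laterCorners_of_ne O f l h]
        refine List.pairwise_cons.2 ⟨fun x hx => ?_, List.pairwise_cons.2 ⟨fun x hx => ?_, ih hl⟩⟩
        · rcases List.mem_cons.1 hx with rfl | hx
          · exact hp q (by simp)
          · obtain ⟨b, hb, hxb⟩ := exists_snd_eq_of_mem_laterCorners O f hx
            rw [hxb]
            exact hp b hb
        · obtain ⟨b, hb, hxb⟩ := exists_snd_eq_of_mem_laterCorners O f hx
          rw [hxb]
          rcases List.mem_cons.1 hb with rfl | hb
          · exact refl_of R _
          · exact (List.pairwise_cons.1 hl).1 b hb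

theorem pairwise_orthogonalPath {R : ℤ → ℤ → Prop} [Std.Refl R] {p q : GridPt} {l : List GridPt}
    (hl : (p :: q :: l).Pairwise (fun p q => R p.2 q.2)) :
    (orthogonalPath O f (p :: q :: l)).Pairwise (fun p q => R p.2 q.2) := by
  by_cases h : p.2 = q.2
  · rw [orthogonalPath_of_eq O f l h]
    refine List.pairwise_cons.2 ⟨fun x hx => ?_, pairwise_laterCorners O f hl⟩
    obtain ⟨b, hb, hxb⟩ := exists_snd_eq_of_mem_laterCorners O f hx
    rw [hxb, attachment_snd]
    rcases List.mem_cons.1 hb with rfl | hb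
    · exact refl_of R _
    · exact (List.pairwise_cons.1 hl).1 b hb
  · rw [orthogonalPath_of_ne O f l h]
    exact pairwise_laterCorners O f hl

end GraphDrawing

namespace GraphDrawing

/-! ### Planarity of the new poly-lines -/

/-- All non-horizontal segments of the poly-line `l`, and its last point, belong to `O`. -/
structure SegmentsIn (O : Set (GridPt × GridPt)) (l : List GridPt) : Prop where
  upward_mem : ∀ a b : GridPt, [a, b] <:+: l → a.2 ≠ b.2 → upward a b ∈ O
  last_mem : ∀ p ∈ l.getLast?, (p, p) ∈ O

theorem SegmentsIn.tail {O : Set (GridPt × GridPt)} {p q : GridPt} {l : List GridPt}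
    (h : SegmentsIn O (p :: q :: l)) : SegmentsIn O (q :: l) where
  upward_mem a b hab := h.upward_mem a b (List.infix_cons_iff.2 (Or.inr hab))
  last_mem := by simpa using h.last_mem

theorem SegmentsIn.head_mem {O : Set (GridPt × GridPt)} {p q : GridPt} {l : List GridPt}
    (h : SegmentsIn O (p :: q :: l)) (hpq : p.2 ≠ q.2) : upward p q ∈ O :=
  h.upward_mem p q ⟨[], l, rfl⟩ hpq

variable {O : Set (GridPt × GridPt)} {f : GridPt × GridPt → ℤ}

theorem self_mem_footprint {p : GridPt} (hp : (p, p) ∈ O) : f (p, p) ∈ footprint O f p :=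
  mem_footprint hp (through_self p)

theorem IsRowLabelling.attachment_mem (H : IsRowLabelling O f) {p : GridPt} (hp : (p, p) ∈ O)
    (q : GridPt) (h : p.2 = q.2) : (attachment O f p q).1 ∈ footprint O f p := by
  have hne : (footprint O f p).Nonempty := ⟨_, self_mem_footprint hp⟩
  simp only [attachment, if_pos h]
  split_ifs
  exacts [H.sSup_mem hne, H.sInf_mem hne]

theorem SegmentsIn.label_mem_left {p q : GridPt} {l : List GridPt}
    (h : SegmentsIn O (p :: q :: l)) (hpq : p.2 ≠ q.2) : f (upward p q) ∈ footprint O f p :=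
  mem_footprint (h.head_mem hpq) (through_upward_left hpq)

theorem SegmentsIn.label_mem_right {p q : GridPt} {l : List GridPt}
    (h : SegmentsIn O (p :: q :: l)) (hpq : p.2 ≠ q.2) : f (upward p q) ∈ footprint O f q :=
  mem_footprint (h.head_mem hpq) (through_upward_right hpq)

theorem segment_row_subset {c p q : GridPt} (hcp : c.2 = p.2) (hpq : p.2 = q.2) :
    segment ℝ c.toPlane q.toPlane ⊆
      segment ℝ c.toPlane p.toPlane ∪ segment ℝ p.toPlane q.toPlane := by
  intro P hP
  rw [mem_segment_of_row (hcp.trans hpq)] at hP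
  rw [Set.mem_union, mem_segment_of_row hcp, mem_segment_of_row hpq]
  rcases Set.uIcc_subset_uIcc_union_uIcc (b := (p.1 : ℝ)) hP.2 with h | h
  · exact Or.inl ⟨hP.1, h⟩
  · exact Or.inr ⟨by rw [hP.1, hcp], h⟩

theorem Corresponds.segment {P Q : ℝ × ℝ} (hPQ : Corresponds O f P Q) {p q : GridPt}
    (hpq : p.2 ≠ q.2) (hs : upward p q ∈ O)
    (hP : P ∈ segment ℝ (GridPt.toPlane (f (upward p q), p.2))
      (GridPt.toPlane (f (upward p q), q.2))) : Q ∈ segment ℝ p.toPlane q.toPlane := by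
  rw [mem_segment_of_column] at hP
  obtain ⟨h1, h2⟩ := hP
  have hcol := hPQ.column _ hs (upward_lt hpq) h1
  unfold upward at hcol
  rcases lt_or_gt_of_ne hpq with h | h
  · have h' : (p.2 : ℝ) ≤ q.2 := by exact_mod_cast h.le
    rw [Set.uIcc_of_le h'] at h2
    rw [if_pos h] at hcol
    exact hcol h2.1 h2.2
  · have h' : (q.2 : ℝ) ≤ p.2 := by exact_mod_cast h.le
    rw [Set.uIcc_of_ge h'] at h2
    rw [if_neg h.not_gt] at hcol
    rw [segment_symm]
    exact hcol h2.1 h2.2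

/-- The point `c` records where the current horizontal piece began. It may differ from `p` because
the recursion passes over a horizontal segment without emitting a corner. -/
theorem IsRowLabelling.mem_trace_laterCorners (H : IsRowLabelling O f) {P Q : ℝ × ℝ}
    (hPQ : Corresponds O f P Q) {l : List GridPt} {a c p : GridPt} (hl : SegmentsIn O (p :: l))
    (ha : a.1 ∈ footprint O f c) (hac : a.2 = c.2) (hcp : c.2 = p.2)
    (hP : P ∈ trace (a :: laterCorners O f (p :: l))) :
    Q ∈ segment ℝ c.toPlane p.toPlane ∪ trace (p :: l) := by
  induction l generalizing a c p with
  | nil =>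
    rw [show P = a.toPlane from hP] at hPQ
    have := hPQ.row ha hac ha hac rfl (left_mem_segment ℝ _ _)
    rw [segment_same] at this
    rw [show Q = c.toPlane from this]
    exact Or.inl (left_mem_segment ℝ _ _)
  | cons q l ih =>
    by_cases h : p.2 = q.2
    · have hQ : Q ∈ segment ℝ c.toPlane q.toPlane ∪ trace (q :: l) := by
        cases l with
        | nil =>
          rw [laterCorners_pair_of_eq O f h] at hP
          have hq : (q, q) ∈ O := hl.last_mem q (by simp)
          have hatt := H.attachment_mem hq p h.symm
          rcases hP with hP | hP
          · exact Or.inl (hPQ.row ha hac hatt rfl (hcp.trans h) hP)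
          · refine Or.inl (hPQ.row ha hac hatt rfl (hcp.trans h) ?_)
            rw [show P = (attachment O f q p).toPlane from hP]
            exact right_mem_segment ℝ _ _
        | cons r l =>
          rw [laterCorners_of_eq O f l h] at hP
          exact ih hl.tail ha hac (hcp.trans h) hP
      rcases hQ with hQ | hQ
      · exact (segment_row_subset hcp h hQ).imp id Or.inl
      · exact Or.inr (trace_tail_subset _ _ hQ)
    · rw [laterCorners_of_ne O f l h] at hP
      rcases hP with hP | hP | hP
      · exact Or.inl (hPQ.row (b := (f (upward p q), p.2)) ha hac (hl.label_mem_left h) rfl hcp hP)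
      · exact Or.inr (Or.inl (hPQ.segment h (hl.head_mem h) hP))
      · refine Or.inr (Or.inr ?_)
        rcases ih (a := (f (upward p q), q.2)) hl.tail (hl.label_mem_right h) rfl rfl hP with hQ | hQ
        · rw [segment_same] at hQ
          rw [show Q = q.toPlane from hQ]
          exact toPlane_mem_trace _ _
        · exact hQ

theorem IsRowLabelling.mem_trace_laterCorners_self (H : IsRowLabelling O f) {P Q : ℝ × ℝ}
    (hPQ : Corresponds O f P Q) {l : List GridPt} {a p : GridPt} (hl : SegmentsIn O (p :: l))
    (ha : a.1 ∈ footprint O f p) (hap : a.2 = p.2)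
    (hP : P ∈ trace (a :: laterCorners O f (p :: l))) : Q ∈ trace (p :: l) := by
  rcases H.mem_trace_laterCorners hPQ hl ha hap rfl hP with hQ | hQ
  · rw [segment_same] at hQ
    rw [show Q = p.toPlane from hQ]
    exact toPlane_mem_trace _ _
  · exact hQ

theorem IsRowLabelling.mem_trace_laterCorners_of_ne (H : IsRowLabelling O f) {P Q : ℝ × ℝ}
    (hPQ : Corresponds O f P Q) {l : List GridPt} {p q : GridPt}
    (hl : SegmentsIn O (p :: q :: l)) (hpq : p.2 ≠ q.2)
    (hP : P ∈ trace (laterCorners O f (p :: q :: l))) : Q ∈ trace (p :: q :: l) :=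
  H.mem_trace_laterCorners_self (a := (f (upward p q), p.2)) hPQ hl (hl.label_mem_left hpq) rfl
    (trace_tail_subset _ _ hP)

theorem IsRowLabelling.mem_trace_orthogonalPath (H : IsRowLabelling O f) {P Q : ℝ × ℝ}
    (hPQ : Corresponds O f P Q) {l : List GridPt} {p q : GridPt}
    (hl : SegmentsIn O (p :: q :: l)) (hp : (p, p) ∈ O)
    (hP : P ∈ trace (orthogonalPath O f (p :: q :: l))) : Q ∈ trace (p :: q :: l) := by
  by_cases h : p.2 = q.2
  · rw [orthogonalPath_of_eq O f l h] at hP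
    exact H.mem_trace_laterCorners_self hPQ hl (H.attachment_mem hp q h) rfl hP
  · rw [orthogonalPath_of_ne O f l h] at hP
    exact H.mem_trace_laterCorners_of_ne hPQ hl h hP

/-- Two consecutive horizontal segments would be collinear. -/
theorem ProperBends.snd_ne {p q r : GridPt} {l : List GridPt} (h : ProperBends (p :: q :: r :: l))
    (hpq : p.2 = q.2) : q.2 ≠ r.2 := by
  intro hqr
  have := h.1
  simp [hpq, hqr] at this

theorem ProperBends.fst_ne {p q r : GridPt} {l : List GridPt}
    (h : ProperBends (p :: q :: r :: l)) : p ≠ r := by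
  rintro rfl
  refine h.1 ?_
  ring

/-- A common point of a new piece and the later part pulls back to one of the old poly-line, which
can only be the joining corner. The hypothesis `hne` reflects that a horizontal segment is never
followed by another. -/
theorem IsRowLabelling.notSelfIntersecting_laterCorners (H : IsRowLabelling O f)
    {l : List GridPt} {a c p : GridPt} (hl : SegmentsIn O (p :: l))
    (hns : NotSelfIntersecting (p :: l)) (hpb : ProperBends (p :: l))
    (hch : (p :: l).IsChain (· ≠ ·)) (ha : a.1 ∈ footprint O f c) (hac : a.2 = c.2)
    (hcp : c.2 = p.2) (hseg : segment ℝ c.toPlane p.toPlane ∩ trace (p :: l) ⊆ {p.toPlane})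
    (hne : c ≠ p → ∀ q ∈ l.head?, p.2 ≠ q.2) :
    NotSelfIntersecting (a :: laterCorners O f (p :: l)) := by
  induction l generalizing a c p with
  | nil => trivial
  | cons q l ih =>
    have hpq := (List.isChain_cons_cons.1 hch).1
    by_cases h : p.2 = q.2
    · cases l with
      | nil =>
        rw [laterCorners_pair_of_eq O f h]
        trivial
      | cons r l =>
        rw [laterCorners_of_eq O f l h]
        obtain rfl : c = p := by
          by_contra hc
          exact hne hc q (by simp) h
        refine ih hl.tail hns.tail hpb.tail hch.of_cons ha hac h hns.segment_inter fun _ x hx => ?_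
        obtain rfl : r = x := by simpa using hx
        exact hpb.snd_ne h
    · rw [laterCorners_of_ne O f l h]
      refine .cons ?_ (.cons ?_ (ih hl.tail hns.tail hpb.tail hch.of_cons (hl.label_mem_right h)
        rfl rfl ?_ fun hc => absurd rfl hc))
      · rintro P ⟨hP, hP' | hP'⟩
        · rw [mem_segment_of_row (b := (f (upward p q), p.2)) (hac.trans hcp)] at hP
          rw [mem_segment_of_column] at hP'
          exact Prod.ext hP'.1 (by rw [hP.1, hac, hcp]; rfl)
        -- Past the vertical piece, `Q` would have to be `p`, which the old poly-line does not
        -- revisit.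
        · obtain ⟨Q, hPQ⟩ := H.exists_corresponds P
          have h1 := hPQ.row (b := (f (upward p q), p.2)) ha hac (hl.label_mem_left h) rfl hcp hP
          have h2 := H.mem_trace_laterCorners_self (a := (f (upward p q), q.2)) hPQ hl.tail
            (hl.label_mem_right h) rfl hP'
          have h3 : Q = p.toPlane := hseg ⟨h1, Or.inr h2⟩
          exact absurd (h3 ▸ h2) (hns.head_notMem hpq)
      · rintro P ⟨hP, hP'⟩
        obtain ⟨Q, hPQ⟩ := H.exists_corresponds P
        have h1 := hPQ.segment h (hl.head_mem h) hP
        have h2 := H.mem_trace_laterCorners_self (a := (f (upward p q), q.2)) hPQ hl.tail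
            (hl.label_mem_right h) rfl hP'
        -- Heights are preserved, so `P` is the point of its vertical line at the height of `q`.
        have h3 : Q = q.toPlane := hns.segment_inter ⟨h1, h2⟩
        rw [mem_segment_of_column] at hP
        exact Prod.ext hP.1 (by rw [← hPQ.snd_eq, h3]; rfl)
      · rw [segment_same]
        exact Set.inter_subset_left

theorem IsRowLabelling.notSelfIntersecting_orthogonalPath (H : IsRowLabelling O f)
    {l : List GridPt} {p q : GridPt} (hl : SegmentsIn O (p :: q :: l)) (hp : (p, p) ∈ O)
    (hns : NotSelfIntersecting (p :: q :: l)) (hpb : ProperBends (p :: q :: l))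
    (hch : (p :: q :: l).IsChain (· ≠ ·)) :
    NotSelfIntersecting (orthogonalPath O f (p :: q :: l)) := by
  have key : ∀ a : GridPt, a.1 ∈ footprint O f p → a.2 = p.2 →
      NotSelfIntersecting (a :: laterCorners O f (p :: q :: l)) := fun a ha hap =>
    H.notSelfIntersecting_laterCorners hl hns hpb hch ha hap rfl
      (by rw [segment_same]; exact Set.inter_subset_left) fun hc => absurd rfl hc
  by_cases h : p.2 = q.2
  · rw [orthogonalPath_of_eq O f l h]
    exact key _ (H.attachment_mem hp q h) rfl
  · rw [orthogonalPath_of_ne O f l h]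
    exact (key (f (p, p), p.2) (self_mem_footprint hp) rfl).tail

/-! ### Bends and attachment points of the new poly-lines -/

theorem ProperBends.cons {p q r : GridPt} {l : List GridPt}
    (h : (q.1 - p.1) * (r.2 - q.2) ≠ (q.2 - p.2) * (r.1 - q.1)) (hl : ProperBends (q :: r :: l)) :
    ProperBends (p :: q :: r :: l) := ⟨h, hl⟩

/-- The corner `(f s, y)` stands for the previous one on the vertical line of `s`, so that the turn
at `a` can be tested; only `y ≠ c.2` matters. Horizontal pieces do not degenerate: distinct segments
have distinct labels, and distinct points of a row have disjoint footprints. -/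
theorem IsRowLabelling.properBends_laterCorners (H : IsRowLabelling O f) {l : List GridPt}
    {a c p : GridPt} {s : GridPt × GridPt} {y : ℤ} (hl : SegmentsIn O (p :: l))
    (hpb : ProperBends (p :: l)) (hch : (p :: l).IsChain (· ≠ ·)) (hs : s ∈ O) (hsc : Through s c)
    (ha : a = (f s, c.2)) (hcp : c.2 = p.2) (hy : y ≠ c.2)
    (hne : c ≠ p → ∀ q ∈ l.head?, p.2 ≠ q.2) (hsp : ∀ q ∈ l.head?, p.2 ≠ q.2 → s ≠ upward p q) :
    ProperBends ((f s, y) :: a :: laterCorners O f (p :: l)) := by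
  induction l generalizing a c p s y with
  | nil => trivial
  | cons q l ih =>
    have hpq := (List.isChain_cons_cons.1 hch).1
    by_cases h : p.2 = q.2
    · obtain rfl : c = p := by
        by_contra hc
        exact hne hc q (by simp) h
      cases l with
      | nil =>
        rw [laterCorners_pair_of_eq O f h]
        have hq : (q, q) ∈ O := hl.last_mem q (by simp)
        have hne' := H.footprint_ne h hpq (mem_footprint hs hsc) (H.attachment_mem hq c h.symm)
        refine .cons ?_ trivial
        subst ha
        simp [attachment_snd, h, sub_eq_zero, hne'.symm, (h ▸ hy).symm]
      | cons r l =>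
        rw [laterCorners_of_eq O f l h]
        refine ih hl.tail hpb.tail hch.of_cons hs hsc ha h hy (fun _ x hx => ?_) fun x hx hqx hsx => ?_
        · obtain rfl : r = x := by simpa using hx
          exact hpb.snd_ne h
        -- A segment contains only one grid point per row, so `s`, which contains `c`, cannot
        -- contain `q` as well.
        · exact hpq (hsc.eq (hsx ▸ through_upward_left hqx) h)
    · rw [laterCorners_of_ne O f l h]
      have hfne : f s ≠ f (upward p q) := fun e =>
        hsp q (by simp) h (H.injOn hs (hl.head_mem h) e)
      refine .cons ?_ (.cons ?_ (ih hl.tail hpb.tail hch.of_cons (hl.head_mem h)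
        (through_upward_right h) rfl rfl h (fun hc => absurd rfl hc) ?_))
      · subst ha
        simp [hcp, sub_eq_zero, hfne.symm, (hcp ▸ hy).symm]
      · subst ha
        simp [hcp, sub_eq_zero, hfne.symm, Ne.symm h]
      · intro r hr hqr
        cases l with
        | nil => simp at hr
        | cons r' l =>
          obtain rfl : r' = r := by simpa using hr
          exact upward_ne h hpb.fst_ne

theorem IsRowLabelling.properBends_orthogonalPath (H : IsRowLabelling O f)
    {l : List GridPt} {p q : GridPt} (hl : SegmentsIn O (p :: q :: l)) (hp : (p, p) ∈ O)
    (hpb : ProperBends (p :: q :: l)) (hch : (p :: q :: l).IsChain (· ≠ ·)) :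
    ProperBends (orthogonalPath O f (p :: q :: l)) := by
  by_cases h : p.2 = q.2
  · rw [orthogonalPath_of_eq O f l h]
    obtain ⟨s, ⟨hs, hsp⟩, hfs⟩ := H.attachment_mem hp q h
    -- An auxiliary vertical piece leads into the start and is dropped by `tail`; any height other
    -- than `p.2` would do.
    refine (H.properBends_laterCorners (y := p.2 + 1) hl hpb hch hs hsp ?_ rfl (by simp)
      (fun hc => absurd rfl hc) fun x hx hpx => ?_).tail
    · exact Prod.ext hfs.symm rfl
    · obtain rfl : q = x := by simpa using hx
      exact absurd h hpx
  · rw [orthogonalPath_of_ne O f l h]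
    -- The degenerate segment of the vertex serves as predecessor; it differs from the first
    -- segment, which has positive height. Both auxiliary corners are dropped.
    refine (H.properBends_laterCorners (y := p.2 + 1) hl hpb hch hp (through_self p) rfl rfl
      (by simp) (fun hc => absurd rfl hc) fun x hx hpx e => ?_).tail.tail
    have := upward_lt hpx
    rw [← e] at this
    exact lt_irrefl _ this

/-- The new edge contains a point of the new segment of its first vertex only as its attachment
point. -/
theorem IsRowLabelling.eq_attachment (H : IsRowLabelling O f) {l : List GridPt} {p q : GridPt}
    (hl : SegmentsIn O (p :: q :: l)) (hp : (p, p) ∈ O) (hns : NotSelfIntersecting (p :: q :: l))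
    (hpb : ProperBends (p :: q :: l)) (hch : (p :: q :: l).IsChain (· ≠ ·)) {P : ℝ × ℝ}
    (hP : P ∈ trace (orthogonalPath O f (p :: q :: l))) (hrow : P.2 = p.2)
    (hinf : ((sInf (footprint O f p) : ℤ) : ℝ) ≤ P.1)
    (hsup : P.1 ≤ ((sSup (footprint O f p) : ℤ) : ℝ)) : P = (attachment O f p q).toPlane := by
  have hpq := (List.isChain_cons_cons.1 hch).1
  obtain ⟨Q, hPQ⟩ := H.exists_corresponds P
  have hQ : Q = p.toPlane := (hPQ.eq_iff p ⟨_, self_mem_footprint hp⟩).2 ⟨hrow, hinf, hsup⟩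
  -- This confines `P` to the first new piece, since later pieces pull back into this trace.
  have hQl : Q ∉ trace (q :: l) := hQ ▸ hns.head_notMem hpq
  by_cases h : p.2 = q.2
  · rw [orthogonalPath_of_eq O f l h] at hP
    have hrowseg : ∀ b : GridPt, b.1 ∈ footprint O f q → b.2 = q.2 →
        P ∈ segment ℝ (attachment O f p q).toPlane b.toPlane →
        P = (attachment O f p q).toPlane := by
      intro b hb hbq hPb
      rw [mem_segment_of_row ((attachment_snd O f p q).trans (h.trans hbq.symm))] at hPb
      refine Prod.ext ?_ hPb.1
      obtain ⟨h1, h2⟩ := hPb.2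
      have hne : (footprint O f p).Nonempty := ⟨_, self_mem_footprint hp⟩
      -- The edge leaves at the end of the box that faces `q`, and all labels at `q` lie beyond that
      -- end.
      by_cases hlt : p.1 < q.1
      · have hatt : (attachment O f p q).1 = sSup (footprint O f p) := by simp [attachment, h, hlt]
        have hab := H.footprint_lt h hlt (H.sSup_mem hne) hb
        rw [hatt, min_eq_left (by exact_mod_cast hab.le)] at h1
        rw [GridPt.toPlane_fst, hatt]
        exact le_antisymm hsup h1
      · have hgt : q.1 < p.1 := by
          refine lt_of_le_of_ne (not_lt.1 hlt) fun e => hpq (Prod.ext e.symm h)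
        have hatt : (attachment O f p q).1 = sInf (footprint O f p) := by simp [attachment, h, hlt]
        have hab := H.footprint_lt h.symm hgt hb (H.sInf_mem hne)
        rw [hatt, max_eq_left (by exact_mod_cast hab.le)] at h2
        rw [GridPt.toPlane_fst, hatt]
        exact le_antisymm h2 hinf
    cases l with
    | nil =>
      rw [laterCorners_pair_of_eq O f h] at hP
      have hq : (q, q) ∈ O := hl.last_mem q (by simp)
      refine hrowseg _ (H.attachment_mem hq p h.symm) rfl ?_
      rcases hP with hP | hP
      · exact hP
      · rw [show P = (attachment O f q p).toPlane from hP]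
        exact right_mem_segment ℝ _ _
    | cons r l =>
      have hqr := hpb.snd_ne h
      rw [laterCorners_of_eq O f l h, laterCorners_of_ne O f l hqr] at hP
      rcases hP with hP | hP
      · exact hrowseg (f (upward q r), q.2) (hl.tail.label_mem_left hqr) rfl hP
      · rw [← laterCorners_of_ne O f l hqr] at hP
        exact absurd (H.mem_trace_laterCorners_of_ne hPQ hl.tail hqr hP) hQl
  · rw [orthogonalPath_of_ne O f l h, laterCorners_of_ne O f l h] at hP
    rcases hP with hP | hP
    · rw [mem_segment_of_column] at hP
      rw [attachment_of_ne O f h]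
      exact Prod.ext hP.1 hrow
    · exact absurd (H.mem_trace_laterCorners_self (a := (f (upward p q), q.2)) hPQ hl.tail
            (hl.label_mem_right h) rfl hP) hQl

theorem IsRowLabelling.attachment_mem_footprint (H : IsRowLabelling O f) {p q : GridPt}
    {l : List GridPt} (hl : SegmentsIn O (p :: q :: l)) (hp : (p, p) ∈ O) :
    (attachment O f p q).1 ∈ footprint O f p := by
  by_cases h : p.2 = q.2
  · exact H.attachment_mem hp q h
  · rw [attachment_of_ne O f h]
    exact hl.label_mem_left h

end GraphDrawing

namespace GraphDrawing

namespace Drawing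

/-! ### Transforming a poly-line drawing -/

variable {V : Type*} {G : SimpleGraph V} {Γ : Drawing G}

/-- The point of a vertex in a poly-line drawing. -/
def point (Γ : Drawing G) (v : V) : GridPt := (Γ.box v).lo

/-- The points of the vertices, and the non-horizontal segments of the edges. -/
def segments (Γ : Drawing G) : Set (GridPt × GridPt) :=
  {s | (∃ v, s = (Γ.point v, Γ.point v)) ∨ ∃ d, [s.1, s.2] <:+: Γ.path d ∧ s.1.2 < s.2.2}

theorem point_mem_segments (v : V) : (Γ.point v, Γ.point v) ∈ Γ.segments := Or.inl ⟨v, rfl⟩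

theorem infix_path_symm {d : G.Dart} {a b : GridPt} (h : [a, b] <:+: Γ.path d) :
    [b, a] <:+: Γ.path d.symm := by
  rw [Γ.path_symm]
  exact List.reverse_infix.2 h

theorem finite_segments [Finite V] (Γ : Drawing G) : Γ.segments.Finite := by
  have : Finite G.Dart := Finite.of_injective _ SimpleGraph.Dart.toProd_injective
  refine ((Set.finite_range fun v => (Γ.point v, Γ.point v)).union (Set.finite_iUnion fun d =>
    (List.finite_toSet (Γ.path d)).prod (List.finite_toSet (Γ.path d)))).subset ?_
  rintro s (⟨v, rfl⟩ | ⟨d, hd, -⟩)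
  · exact Or.inl ⟨v, rfl⟩
  · exact Or.inr (Set.mem_iUnion.2 ⟨d, hd.subset (by simp), hd.subset (by simp)⟩)

namespace IsPolyLine

variable (hΓ : Γ.IsPolyLine)
include hΓ

theorem region_eq (v : V) : (Γ.box v).region = {(Γ.point v).toPlane} := by
  rw [Box.region, ← hΓ v, Set.Icc_self]
  rfl

theorem point_injective : Function.Injective Γ.point := by
  intro u v h
  by_contra hne
  have := Γ.disjoint_boxes u v hne
  rw [hΓ.region_eq, hΓ.region_eq, h] at this
  simp at this

theorem head_path (d : G.Dart) : (Γ.path d).head? = some (Γ.point d.fst) := by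
  obtain ⟨a, ha, h⟩ := Γ.attached d
  have : a.toPlane ∈ (Γ.box d.fst).region :=
    (h.ge (Set.mem_singleton a.toPlane)).2
  rw [hΓ.region_eq] at this
  rw [ha, GridPt.toPlane_injective this]

theorem getLast_path (d : G.Dart) : (Γ.path d).getLast? = some (Γ.point d.snd) := by
  have := hΓ.head_path d.symm
  rwa [Γ.path_symm, List.head?_reverse] at this

theorem exists_path (d : G.Dart) : ∃ q l, Γ.path d = Γ.point d.fst :: q :: l := by
  have h1 := hΓ.head_path d
  have h2 := hΓ.getLast_path d
  rcases h : Γ.path d with _ | ⟨p, _ | ⟨q, l⟩⟩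
  · simp [h] at h1
  · rw [h] at h1 h2
    simp only [List.head?_cons, List.getLast?_singleton, Option.some.injEq] at h1 h2
    exact absurd (hΓ.point_injective (h1.symm.trans h2)) d.adj.ne
  · rw [h] at h1
    simp only [List.head?_cons, Option.some.injEq] at h1
    exact ⟨q, l, by rw [h1]⟩

/-- An edge without bends joins the distinct points of two vertices; otherwise the bends exclude
repeated corners. -/
theorem isChain_path (d : G.Dart) : (Γ.path d).IsChain (· ≠ ·) := by
  obtain ⟨q, l, h⟩ := hΓ.exists_path d
  have hpb := Γ.properBends d
  have hlast := hΓ.getLast_path d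
  rw [h] at hpb hlast ⊢
  cases l with
  | nil =>
    simp only [List.getLast?_cons_cons, List.getLast?_singleton, Option.some.injEq] at hlast
    rw [hlast]
    simpa using hΓ.point_injective.ne d.adj.ne
  | cons r l => exact hpb.isChain_ne

theorem segmentsIn (d : G.Dart) : SegmentsIn Γ.segments (Γ.path d) where
  upward_mem a b hab hne := by
    unfold upward
    rcases lt_or_gt_of_ne hne with h | h
    · rw [if_pos h]
      exact Or.inr ⟨d, hab, h⟩
    · rw [if_neg h.not_gt]
      exact Or.inr ⟨d.symm, infix_path_symm hab, h⟩
  last_mem p hp := by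
    rw [hΓ.getLast_path d] at hp
    obtain rfl : Γ.point d.snd = p := by simpa using hp
    exact point_mem_segments _

/-- The first vertex lies only at the start of the first segment, as the edge does not intersect
itself; the reversed dart handles the other vertex. -/
theorem point_eq_of_mem_segment {d : G.Dart} {v : V} (hv : v ∈ d.edge) {a b : GridPt}
    (hab : [a, b] <:+: Γ.path d) (h : (Γ.point v).toPlane ∈ segment ℝ a.toPlane b.toPlane) :
    Γ.point v = a ∨ Γ.point v = b := by
  have key : ∀ (e : G.Dart) (a b : GridPt), [a, b] <:+: Γ.path e →
      (Γ.point e.fst).toPlane ∈ segment ℝ a.toPlane b.toPlane → Γ.point e.fst = a := by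
    intro e a b hab h
    have hns := Γ.notSelfIntersecting e
    have hch := hΓ.isChain_path e
    obtain ⟨q, l, hp⟩ := hΓ.exists_path e
    rw [hp] at hab hns hch
    exact hns.eq_head hch hab h
  rcases Sym2.mem_iff.1 (show v ∈ s(d.fst, d.snd) from hv) with rfl | rfl
  · exact Or.inl (key d a b hab h)
  · exact Or.inr (key d.symm b a (infix_path_symm hab) (by rwa [segment_symm]))

/-- A common interior point would be a self-intersection of an edge, or else a common vertex of two
edges, which lies on a segment only as one of its ends. -/
theorem nonCrossing {s t : GridPt × GridPt} (hs : s ∈ Γ.segments) (ht : t ∈ Γ.segments)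
    (hne : s ≠ t) : NonCrossing s t := by
  intro y hs1 hs2 ht1 ht2 hst
  rcases hs with ⟨v, rfl⟩ | ⟨d, hd, hslt⟩
  · exact lt_asymm hs1 hs2
  rcases ht with ⟨v, rfl⟩ | ⟨e, he, htlt⟩
  · exact lt_asymm ht1 ht2
  have hPs : ((xAt s y, y) : ℝ × ℝ) ∈ segment ℝ s.1.toPlane s.2.toPlane :=
    (mem_segment_of_lt hslt).2 ⟨hs1.le, hs2.le, rfl⟩
  have hPt : ((xAt s y, y) : ℝ × ℝ) ∈ segment ℝ t.1.toPlane t.2.toPlane :=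
    (mem_segment_of_lt htlt).2 ⟨ht1.le, ht2.le, hst⟩
  have ne : ∀ p : GridPt, ((xAt s y, y) : ℝ × ℝ) = p.toPlane → y = p.2 := fun p h =>
    congrArg Prod.snd h
  by_cases hde : d.edge = e.edge
  · rcases SimpleGraph.dart_edge_eq_iff d e |>.1 hde with rfl | rfl
    · rcases (Γ.notSelfIntersecting d).mem_ends hd he hne hPs hPt with h | h
      · exact hs2.ne (ne _ h)
      · exact ht2.ne (ne _ h)
    -- On the reversed dart `s` is traversed downwards, so it cannot coincide with the upward
    -- segment `t`.
    · rcases (Γ.notSelfIntersecting e).mem_ends (by simpa using infix_path_symm hd) he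
        (by
          intro h
          rw [Prod.mk.injEq] at h
          rw [h.1, h.2] at hslt
          exact lt_asymm hslt htlt) (by rwa [segment_symm]) hPt with h | h
      · exact hs1.ne' (ne _ h)
      · exact ht2.ne (ne _ h)
  · obtain ⟨v, hv, -, hP⟩ := Γ.path_inter_path d e hde _
      ⟨segment_subset_trace hd hPs, segment_subset_trace he hPt⟩
    rw [hΓ.region_eq] at hP
    have hP' : ((xAt s y, y) : ℝ × ℝ) = (Γ.point v).toPlane := hP
    have hy := ne _ hP'
    rcases hΓ.point_eq_of_mem_segment hv hd (hP' ▸ hPs) with h | h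
    · exact hs1.ne' (by rw [hy, h])
    · exact hs2.ne (by rw [hy, h])

theorem exists_labelling [Finite V] : ∃ f, IsRowLabelling Γ.segments f :=
  exists_isRowLabelling Γ.finite_segments
    (by
      rintro s (⟨v, rfl⟩ | ⟨d, -, h⟩)
      · exact Or.inr rfl
      · exact Or.inl h)
    fun _ hs _ ht hne => hΓ.nonCrossing hs ht hne

end IsPolyLine

variable {f : GridPt × GridPt → ℤ}

theorem footprint_nonempty (v : V) : (footprint Γ.segments f (Γ.point v)).Nonempty :=
  ⟨_, self_mem_footprint (point_mem_segments v)⟩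

/-- The horizontal segment that replaces the point of a vertex. -/
noncomputable def flatBox (H : IsRowLabelling Γ.segments f) (v : V) : Box where
  lo := (sInf (footprint Γ.segments f (Γ.point v)), (Γ.point v).2)
  hi := (sSup (footprint Γ.segments f (Γ.point v)), (Γ.point v).2)
  lo_le_hi := ⟨H.sInf_le (H.sSup_mem (footprint_nonempty v)), le_rfl⟩

theorem mem_region_flatBox (H : IsRowLabelling Γ.segments f) (v : V) (P : ℝ × ℝ) :
    P ∈ (flatBox H v).region ↔ P.2 = (Γ.point v).2 ∧
      ((sInf (footprint Γ.segments f (Γ.point v)) : ℤ) : ℝ) ≤ P.1 ∧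
      P.1 ≤ ((sSup (footprint Γ.segments f (Γ.point v)) : ℤ) : ℝ) := by
  simp only [Box.region, flatBox, Set.mem_Icc, Prod.le_def, GridPt.toPlane_fst,
    GridPt.toPlane_snd]
  constructor
  · rintro ⟨⟨h1, h2⟩, h3, h4⟩
    exact ⟨le_antisymm h4 h2, h1, h3⟩
  · rintro ⟨h1, h2, h3⟩
    exact ⟨⟨h2, h1.ge⟩, h3, h1.le⟩

theorem mem_region_flatBox_iff (H : IsRowLabelling Γ.segments f) (v : V) {P Q : ℝ × ℝ}
    (hPQ : Corresponds Γ.segments f P Q) :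
    P ∈ (flatBox H v).region ↔ Q = (Γ.point v).toPlane := by
  rw [mem_region_flatBox, hPQ.eq_iff _ (footprint_nonempty v)]

theorem mem_trace_of_corresponds (hΓ : Γ.IsPolyLine) (H : IsRowLabelling Γ.segments f)
    (d : G.Dart) {P Q : ℝ × ℝ} (hPQ : Corresponds Γ.segments f P Q)
    (hP : P ∈ trace (orthogonalPath Γ.segments f (Γ.path d))) : Q ∈ trace (Γ.path d) := by
  have hseg := hΓ.segmentsIn d
  obtain ⟨q, l, h⟩ := hΓ.exists_path d
  rw [h] at hP hseg ⊢
  exact H.mem_trace_orthogonalPath hPQ hseg (point_mem_segments _) hP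

/-- The flat orthogonal drawing that is obtained from a poly-line drawing by placing each
non-horizontal segment on the vertical line of its label. -/
noncomputable def flatDrawing (hΓ : Γ.IsPolyLine) (H : IsRowLabelling Γ.segments f) :
    Drawing G where
  box := flatBox H
  path d := orthogonalPath Γ.segments f (Γ.path d)
  path_symm d := by rw [Γ.path_symm, orthogonalPath_reverse]
  attached d := by
    have hseg := hΓ.segmentsIn d
    have hns := Γ.notSelfIntersecting d
    have hpb := Γ.properBends d
    have hch := hΓ.isChain_path d
    obtain ⟨q, l, h⟩ := hΓ.exists_path d
    rw [h] at hseg hns hpb hch ⊢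
    have hp : (Γ.point d.fst, Γ.point d.fst) ∈ Γ.segments := point_mem_segments _
    refine ⟨attachment Γ.segments f (Γ.point d.fst) q, rfl, Set.Subset.antisymm ?_ ?_⟩
    · rintro P ⟨hP, hPbox⟩
      obtain ⟨h1, h2, h3⟩ := (mem_region_flatBox H _ _).1 hPbox
      exact H.eq_attachment hseg hp hns hpb hch hP h1 h2 h3
    · rintro _ rfl
      have hmem := H.attachment_mem_footprint hseg hp
      exact ⟨toPlane_mem_trace _ _, (mem_region_flatBox H _ _).2 ⟨rfl,
        Int.cast_le.2 (H.sInf_le hmem), Int.cast_le.2 (H.le_sSup hmem)⟩⟩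
  properBends d := by
    have hseg := hΓ.segmentsIn d
    have hpb := Γ.properBends d
    have hch := hΓ.isChain_path d
    obtain ⟨q, l, h⟩ := hΓ.exists_path d
    rw [h] at hseg hpb hch ⊢
    exact H.properBends_orthogonalPath hseg (point_mem_segments _) hpb hch
  notSelfIntersecting d := by
    have hseg := hΓ.segmentsIn d
    have hns := Γ.notSelfIntersecting d
    have hpb := Γ.properBends d
    have hch := hΓ.isChain_path d
    obtain ⟨q, l, h⟩ := hΓ.exists_path d
    rw [h] at hseg hns hpb hch ⊢
    exact H.notSelfIntersecting_orthogonalPath hseg (point_mem_segments _) hns hpb hch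
  disjoint_boxes u v huv := by
    refine Set.disjoint_left.2 fun P hu hv => huv ?_
    obtain ⟨Q, hPQ⟩ := H.exists_corresponds P
    rw [mem_region_flatBox_iff H _ hPQ] at hu hv
    exact hΓ.point_injective (GridPt.toPlane_injective (hu.symm.trans hv))
  disjoint_path_box d v hv := by
    refine Set.disjoint_left.2 fun P hP hPv => ?_
    obtain ⟨Q, hPQ⟩ := H.exists_corresponds P
    rw [mem_region_flatBox_iff H _ hPQ] at hPv
    refine Set.disjoint_left.1 (Γ.disjoint_path_box d v hv)
      (mem_trace_of_corresponds hΓ H d hPQ hP) ?_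
    rw [hΓ.region_eq]
    exact hPv
  path_inter_path d e hde P hP := by
    obtain ⟨Q, hPQ⟩ := H.exists_corresponds P
    obtain ⟨v, hvd, hve, hv⟩ := Γ.path_inter_path d e hde Q
      ⟨mem_trace_of_corresponds hΓ H d hPQ hP.1, mem_trace_of_corresponds hΓ H e hPQ hP.2⟩
    rw [hΓ.region_eq] at hv
    -- The converse half of the box correspondence: the old meeting point is the vertex, hence `P`
    -- is in its new box.
    exact ⟨v, hvd, hve, (mem_region_flatBox_iff H v hPQ).2 hv⟩

end Drawing

end GraphDrawing

/-! ### The flat orthogonal drawing has the required properties -/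

theorem mainTheorem4 {V : Type*} [Finite V] (G : SimpleGraph V)
    (Γ : GraphDrawing.Drawing G) (hΓ : Γ.IsPolyLine) :
    ∃ Γ' : GraphDrawing.Drawing G,
      Γ'.IsOrthogonal ∧ Γ'.IsFlat ∧ Γ.SameY Γ' ∧ Γ.SameRowOrder Γ' ∧
        (Γ.IsYMonotone → Γ'.IsYMonotone) := by
  obtain ⟨f, H⟩ := hΓ.exists_labelling
  refine ⟨GraphDrawing.Drawing.flatDrawing hΓ H, fun d => ?_, fun v => rfl,
    ⟨fun v => ⟨rfl, ?_⟩, fun d => ⟨GraphDrawing.bendGroups f (Γ.path d), ?_, ?_⟩⟩,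
    fun v w hrow hlt => ?_, fun hmono d => ?_⟩
  · obtain ⟨q, l, h⟩ := hΓ.exists_path d
    change (GraphDrawing.orthogonalPath Γ.segments f (Γ.path d)).IsChain _
    rw [h]
    exact GraphDrawing.isChain_orthogonalPath _ _ _ _ _
  · rw [← hΓ v]
    rfl
  · obtain ⟨q, l, h⟩ := hΓ.exists_path d
    change _ = (GraphDrawing.orthogonalPath Γ.segments f (Γ.path d)).tail.dropLast
    rw [h, GraphDrawing.orthogonalPath_bends]
  · obtain ⟨q, l, h⟩ := hΓ.exists_path d
    rw [GraphDrawing.Drawing.bends, h]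
    exact GraphDrawing.forall₂_bendGroups f _ _
  · rw [← hΓ v] at hlt
    -- It suffices to compare the largest label at `v` with the smallest at `w`.
    exact H.footprint_lt hrow hlt (H.sSup_mem (GraphDrawing.Drawing.footprint_nonempty v))
      (H.sInf_mem (GraphDrawing.Drawing.footprint_nonempty w))
  · obtain ⟨q, l, h⟩ := hΓ.exists_path d
    have hd := hmono d
    change (GraphDrawing.orthogonalPath Γ.segments f (Γ.path d)).Pairwise _ ∨
      (GraphDrawing.orthogonalPath Γ.segments f (Γ.path d)).Pairwise _
    rw [h] at hd ⊢
    exact hd.imp (GraphDrawing.pairwise_orthogonalPath _ f (R := (· ≤ ·)))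
      (GraphDrawing.pairwise_orthogonalPath _ f (R := (· ≥ ·)))
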